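/- Let $N,M\ge 1$, let $\Omega\subset\mathbb{R}^N$ be a domain, $p>2$, with $p\le 2^*:=\frac{2N}{N-2}$ if $N\ge 3$. Let $\kappa_i\in\mathbb{R}$ and $\mu_i>0$ for $i=1,\dots,M$, and for $i\ne j$ let $\lambda_{ij}=\lambda_{ji}<0$, $\alpha_{ij},\beta_{ij}>1$, $\alpha_{ij}=\beta_{ji}$, $\alpha_{ij}+\beta_{ij}=p$. Let $H$ be either $H^1_0(\Omega)$ or $D^{1,2}_0(\Omega)$, where in the second case, unless $N\ge 3$ and $p=2^*$, it is assumed that $D^{1,2}_0(\Omega)$ is continuously embedded in $L^p(\Omega)$, that is, $\|\varphi\|_{L^p}\le C\|\nabla\varphi\|_{L^2}$ for all $\varphi\in C_c^\infty(\Omega)$. Assume that the operators $-\Delta+\kappa_i$ are well defined and coercive in $H$, i.e. $H\subset L^2(\Omega)$ if some $\kappa_i\neq 0$, and $\langle v,v\rangle_i\ge c\|v\|_H^2$ for some $c>0$ and all $v\in H$, $i=1,\dots,M$, where $\langle v,w\rangle_i:=\int_\Omega(\nabla v\cdot\nabla w+\kappa_i vw)$ and $\|\cdot\|_H$ is the standard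 norm of $H$. Put $\|v\|_i:=\langle v,v\rangle_i^{1/2}$, and let $\mathcal{H}:=H^M$ with the norm $\|u\|:=(\sum_i\|u_i\|_i^2)^{1/2}$. Let $$\mathcal{J}(u):=\frac12\sum_{i}\|u_i\|_i^2-\frac1p\sum_{i}\int_\Omega\mu_i|u_i|^p-\frac12\sum_{i}\sum_{j\ne i}\int_\Omega\lambda_{ij}|u_j|^{\alpha_{ij}}|u_i|^{\beta_{ij}},\qquad u\in\mathcal{H},$$ $$\mathcal{N}:=\{u\in\mathcal{H}: u_i\ne 0\text{ and }\partial_i\mathcal{J}(u)u_i=0\text{ for all }i\}.$$ For $s\in\mathbb{R}^M$ write $su:=(s_1u_1,\dots,s_Mu_M)$. Let $\widetilde{\mathcal{U}}$ be the set of $u\in\mathcal{H}$ such that $su\in\mathcal{N}$ for some $s\in(0,\infty)^M$, let $\mathcal{T}:=\{u\in\mathcal{H}:\|u_i\|_i=1\text{ for all }i\}$, $\mathcal{U}:=\widetilde{\mathcal{U}}\cap\mathcal{T}$, let $\partial\mathcal{U}$ be the boundary of $\mathcal{U}$ in $\mathcal{T}$, and, for $u\in\mathcal{T}$, let $\mathrm{T}_u(\mathcal{T}):=\{v\in\mathcal{H}:\langle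 u_i,v_i\rangle_i=0\text{ for all }i\}$. Then $\mathcal{J}$ is of class $\mathcal{C}^1$; for each $u\in\widetilde{\mathcal{U}}$ there is exactly one $s_u\in(0,\infty)^M$ with $s_uu\in\mathcal{N}$; $\mathcal{U}$ is open in $\mathcal{T}$; and $\mathfrak{m}(u):=s_uu$ defines a bijection $\mathfrak{m}:\mathcal{U}\to\mathcal{N}$. Put $\Psi(u):=\mathcal{J}(s_uu)$ for $u\in\mathcal{U}$. The following hold. (i) $\Psi\in\mathcal{C}^1(\mathcal{U},\mathbb{R})$, and $\Psi'(u)v=\mathcal{J}'(\mathfrak{m}(u))[s_uv]$ for all $u\in\mathcal{U}$ and $v\in\mathrm{T}_u(\mathcal{T})$. (ii) Call $(u_n)$ in $\mathcal{U}$ a $(PS)_c$-sequence for $\Psi$ if $\Psi(u_n)\to c$ and $\|\Psi'(u_n)\|_*\to 0$, where $\|\Psi'(u)\|_*:=\sup_{0\ne v\in\mathrm{T}_u(\mathcal{T})}|\Psi'(u)v|/\|v\|$, and call $(u_n)$ in $\mathcal{H}$ a $(PS)_c$-sequence for $\mathcal{J}$ if $\mathcal{J}(u_n)\to c$ and $\|\mathcal{J}'(u_n)\|_{\mathcal{H}^{-1}}\to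 0$ (the dual norm). If $(u_n)$ is a $(PS)_c$-sequence for $\Psi$, then $(\mathfrak{m}(u_n))$ is a $(PS)_c$-sequence for $\mathcal{J}$. Conversely, if $(u_n)$ is a $(PS)_c$-sequence for $\mathcal{J}$ and $u_n\in\mathcal{N}$ for all $n$, then $(\mathfrak{m}^{-1}(u_n))$ is a $(PS)_c$-sequence for $\Psi$. (iii) For $u\in\mathcal{U}$: $u$ is a critical point of $\Psi$ (that is, $\Psi'(u)v=0$ for all $v\in\mathrm{T}_u(\mathcal{T})$) if and only if $\mathfrak{m}(u)$ is a critical point of $\mathcal{J}$ that is fully nontrivial, i.e., all of whose components are nonzero. (iv) If $(u_n)$ is a sequence in $\mathcal{U}$ such that $u_n\to u\in\partial\mathcal{U}$, then $\Psi(u_n)\to\infty$. (v) $\Psi$ is even: if $u\in\mathcal{U}$, then $-u\in\mathcal{U}$ and $\Psi(u)=\Psi(-u)$. -/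

import Mathlib

open MeasureTheory Set Filter Topology
open scoped ENNReal ContDiff

noncomputable section

/-- The pairs `(φ, ∇φ)`, with `φ` a smooth function with compact support in `Ω`, as a linear
subspace of `L^q(Ω) × L²(Ω; ℝ^N)`. -/
def testPairs {N : ℕ} (Ω : Set (EuclideanSpace ℝ (Fin N))) (q : ℝ≥0∞) [Fact (1 ≤ q)] :
    Submodule ℝ (Lp ℝ q (volume.restrict Ω) ×
      Lp (EuclideanSpace ℝ (Fin N)) 2 (volume.restrict Ω)) where
  carrier := {w | ∃ φ : EuclideanSpace ℝ (Fin N) → ℝ, ContDiff ℝ ∞ φ ∧ HasCompactSupport φ ∧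
    tsupport φ ⊆ Ω ∧ w.1 =ᵐ[volume.restrict Ω] φ ∧ w.2 =ᵐ[volume.restrict Ω] gradient φ}
  add_mem' := by
    rintro a b ⟨φ, h1, h2, h3, h4, h5⟩ ⟨ψ, k1, k2, k3, k4, k5⟩
    refine ⟨φ + ψ, h1.add k1, h2.add k2,
      (tsupport_add φ ψ).trans (union_subset h3 k3), ?_, ?_⟩
    · filter_upwards [Lp.coeFn_add a.1 b.1, h4, k4] with x e1 e2 e3
      exact e1.trans (by simp [e2, e3])
    · filter_upwards [Lp.coeFn_add a.2 b.2, h5, k5] with x e1 e2 e3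
      have hφ : DifferentiableAt ℝ φ x := h1.differentiable (by simp) x
      have hψ : DifferentiableAt ℝ ψ x := k1.differentiable (by simp) x
      exact e1.trans (by simp [e2, e3, gradient, fderiv_add hφ hψ])
  zero_mem' := by
    refine ⟨0, contDiff_const, HasCompactSupport.zero, by simp, ?_, ?_⟩
    · exact Lp.coeFn_zero ..
    · filter_upwards [Lp.coeFn_zero (EuclideanSpace ℝ (Fin N)) 2 (volume.restrict Ω)] with x hx
      exact hx.trans (by simp [gradient])
  smul_mem' := by
    rintro c a ⟨φ, h1, h2, h3, h4, h5⟩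
    refine ⟨c • φ, h1.const_smul c, h2.smul_left (f := fun _ => c),
      (closure_mono (Function.support_const_smul_subset c φ)).trans h3, ?_, ?_⟩
    · filter_upwards [Lp.coeFn_smul c a.1, h4] with x e1 e2
      exact e1.trans (by simp [e2])
    · filter_upwards [Lp.coeFn_smul c a.2, h5] with x e1 e2
      have hφ : DifferentiableAt ℝ φ x := h1.differentiable (by simp) x
      exact e1.trans (by simp [e2, gradient, fderiv_const_smul hφ])

/-- The closure of `{(φ, ∇φ) : φ ∈ C_c^∞(Ω)}` in `L^q(Ω) × L²(Ω; ℝ^N)`: the functions `u` in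
`L^q(Ω)` that are limits of test functions whose gradients converge in `L²`, each together with
its weak gradient. -/
def sobolevZero {N : ℕ} (Ω : Set (EuclideanSpace ℝ (Fin N))) (q : ℝ≥0∞) [Fact (1 ≤ q)] :
    Submodule ℝ (Lp ℝ q (volume.restrict Ω) ×
      Lp (EuclideanSpace ℝ (Fin N)) 2 (volume.restrict Ω)) :=
  (testPairs Ω q).topologicalClosure

/-- The two choices of the function space: `H10` stands for `H^1_0(Ω)`, and `D120` for
`D^{1,2}_0(Ω)`. -/
inductive SobolevKind where
  | H10
  | D120

/-- The data of the weakly coupled competitive system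
`-Δ u_i + κ_i u_i = μ_i |u_i|^{p-2} u_i + ∑_{j ≠ i} λ_{ij} β_{ij} |u_j|^{α_{ij}} |u_i|^{β_{ij}-2} u_i`,
`u_i ∈ H`, `i = 1, …, M`, in a domain `Ω` of `ℝ^N`, where `H` is `H^1_0(Ω)` or `D^{1,2}_0(Ω)`.
The exponent satisfies `2 < p`, and `p ≤ 2^* = 2N/(N-2)` if `N ≥ 3`. Only the entries
`lam i j`, `α i j`, `β i j` with `i ≠ j` play a role. -/
structure CompetitiveSystem (N M : ℕ) where
  Ω : Set (EuclideanSpace ℝ (Fin N))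
  isOpen_Ω : IsOpen Ω
  isConnected_Ω : IsConnected Ω
  kind : SobolevKind
  p : ℝ
  two_lt_p : 2 < p
  p_le : 3 ≤ N → p ≤ 2 * (N : ℝ) / ((N : ℝ) - 2)
  κ : Fin M → ℝ
  μ : Fin M → ℝ
  μ_pos : ∀ i, 0 < μ i
  lam : Fin M → Fin M → ℝ
  lam_symm : ∀ i j, i ≠ j → lam i j = lam j i
  lam_neg : ∀ i j, i ≠ j → lam i j < 0
  α : Fin M → Fin M → ℝ
  β : Fin M → Fin M → ℝ
  one_lt_α : ∀ i j, i ≠ j → 1 < α i j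
  one_lt_β : ∀ i j, i ≠ j → 1 < β i j
  α_eq_β : ∀ i j, i ≠ j → α i j = β j i
  α_add_β : ∀ i j, i ≠ j → α i j + β i j = p

namespace CompetitiveSystem

/-- The exponent of the Lebesgue space in which `H` is realized: `2` for `H^1_0(Ω)`, `p` for
`D^{1,2}_0(Ω)`. -/
def q {N M : ℕ} (S : CompetitiveSystem N M) : ℝ≥0∞ :=
  match S.kind with
  | .H10 => 2
  | .D120 => ENNReal.ofReal S.p

instance fact_one_le_q {N M : ℕ} (S : CompetitiveSystem N M) : Fact (1 ≤ S.q) := by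
  constructor
  unfold q
  cases S.kind with
  | H10 => exact one_le_two
  | D120 => exact ENNReal.one_le_ofReal.2 (by linarith [S.two_lt_p])

/-- The space `H`. If `kind = H10`, it is `H^1_0(Ω)`, the closure of the test functions in the
`H^1`-norm. If `kind = D120`, it is `D^{1,2}_0(Ω)`: when `‖φ‖_p ≤ C ‖∇φ‖_2` for all test
functions (see `SobolevEmbedding`; this always holds if `N ≥ 3` and `p = 2^*`), the completion of
the test functions in the norm `‖∇φ‖_2` is a space of functions in `L^p(Ω)`, and it is this
closure; the norm inherited from `L^q × L²` is equivalent to `‖∇u‖_2`. -/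
abbrev H {N M : ℕ} (S : CompetitiveSystem N M) : Type := ↥(sobolevZero S.Ω S.q)

/-- The function underlying an element of `H`. -/
def fn {N M : ℕ} (S : CompetitiveSystem N M) (v : S.H) : EuclideanSpace ℝ (Fin N) → ℝ :=
  (v : Lp ℝ S.q (volume.restrict S.Ω) × Lp (EuclideanSpace ℝ (Fin N)) 2 (volume.restrict S.Ω)).1

/-- The weak gradient of an element of `H`. -/
def grad {N M : ℕ} (S : CompetitiveSystem N M) (v : S.H) :
    EuclideanSpace ℝ (Fin N) → EuclideanSpace ℝ (Fin N) :=
  (v : Lp ℝ S.q (volume.restrict S.Ω) × Lp (EuclideanSpace ℝ (Fin N)) 2 (volume.restrict S.Ω)).2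

/-- If `H = D^{1,2}_0(Ω)`, then either `N ≥ 3` and `p = 2^*`, or `D^{1,2}_0(Ω)` embeds
continuously in `L^p(Ω)`. Nothing is required if `H = H^1_0(Ω)`. -/
def SobolevEmbedding {N M : ℕ} (S : CompetitiveSystem N M) : Prop :=
  match S.kind with
  | .H10 => True
  | .D120 => (3 ≤ N ∧ S.p = 2 * (N : ℝ) / ((N : ℝ) - 2)) ∨
      ∃ C : ℝ, ∀ φ : EuclideanSpace ℝ (Fin N) → ℝ, ContDiff ℝ ∞ φ → HasCompactSupport φ →
        tsupport φ ⊆ S.Ω →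
        eLpNorm φ (ENNReal.ofReal S.p) volume ≤
          ENNReal.ofReal C * eLpNorm (gradient φ) 2 volume

/-- `⟨v, w⟩_i = ∫_Ω (∇v · ∇w + κ_i v w)`. -/
def innerI {N M : ℕ} (S : CompetitiveSystem N M) (i : Fin M) (v w : S.H) : ℝ :=
  ∫ x in S.Ω, (inner ℝ (S.grad v x) (S.grad w x) + S.κ i * (S.fn v x * S.fn w x))

/-- `‖v‖_i = ⟨v, v⟩_i^{1/2}`. -/
def normI {N M : ℕ} (S : CompetitiveSystem N M) (i : Fin M) (v : S.H) : ℝ :=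
  Real.sqrt (S.innerI i v v)

/-- The square of the standard norm of `H`: `∫ |∇v|² + v²` in `H^1_0(Ω)`, and `∫ |∇v|²` in
`D^{1,2}_0(Ω)`. -/
def stdNormSq {N M : ℕ} (S : CompetitiveSystem N M) (v : S.H) : ℝ :=
  match S.kind with
  | .H10 => ∫ x in S.Ω, (‖S.grad v x‖ ^ 2 + S.fn v x ^ 2)
  | .D120 => ∫ x in S.Ω, ‖S.grad v x‖ ^ 2

/-- The operators `-Δ + κ_i` are well defined and coercive in `H`. -/
def Coercive {N M : ℕ} (S : CompetitiveSystem N M) : Prop :=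
  ∀ i, (S.κ i ≠ 0 → ∀ v : S.H, MemLp (S.fn v) 2 (volume.restrict S.Ω)) ∧
    ∃ c : ℝ, 0 < c ∧ ∀ v : S.H, c * S.stdNormSq v ≤ S.innerI i v v

/-- The space `ℋ = H^M`; its topology is the one of the norm `hNorm`. -/
abbrev HM {N M : ℕ} (S : CompetitiveSystem N M) : Type := Fin M → S.H

/-- `‖(u_1, …, u_M)‖ = (∑ ‖u_i‖_i²)^{1/2}`. -/
def hNorm {N M : ℕ} (S : CompetitiveSystem N M) (u : S.HM) : ℝ :=
  Real.sqrt (∑ i, S.normI i (u i) ^ 2)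

/-- The energy functional `𝒥`. -/
def J {N M : ℕ} (S : CompetitiveSystem N M) (u : S.HM) : ℝ :=
  1 / 2 * (∑ i, S.normI i (u i) ^ 2)
    - 1 / S.p * (∑ i, (∫ x in S.Ω, S.μ i * |S.fn (u i) x| ^ S.p))
    - 1 / 2 * (∑ i, ∑ j ∈ Finset.univ.filter (fun j => j ≠ i),
        (∫ x in S.Ω, S.lam i j * |S.fn (u j) x| ^ S.α i j * |S.fn (u i) x| ^ S.β i j))

/-- `su = (s_1 u_1, …, s_M u_M)`. -/
def scale {N M : ℕ} (S : CompetitiveSystem N M) (s : Fin M → ℝ) (u : S.HM) : S.HM :=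
  fun i => s i • u i

/-- The Nehari-type set `𝒩 = {u : u_i ≠ 0 and ∂_i 𝒥(u) u_i = 0 for all i}`. -/
def nehari {N M : ℕ} (S : CompetitiveSystem N M) : Set S.HM :=
  {u | ∀ i, u i ≠ 0 ∧ fderiv ℝ S.J u (Pi.single i (u i)) = 0}

/-- `{u ∈ ℋ : su ∈ 𝒩 for some s ∈ (0,∞)^M}`. -/
def Utilde {N M : ℕ} (S : CompetitiveSystem N M) : Set S.HM :=
  {u | ∃ s : Fin M → ℝ, (∀ i, 0 < s i) ∧ S.scale s u ∈ S.nehari}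

open Classical in
/-- The vector `s_u ∈ (0,∞)^M` such that `s_u u ∈ 𝒩`, for `u ∈ Utilde` (`0` elsewhere). -/
def sOf {N M : ℕ} (S : CompetitiveSystem N M) (u : S.HM) : Fin M → ℝ :=
  if h : ∃ s : Fin M → ℝ, (∀ i, 0 < s i) ∧ S.scale s u ∈ S.nehari then h.choose else 0

/-- `𝔪(u) = s_u u`. -/
def m {N M : ℕ} (S : CompetitiveSystem N M) (u : S.HM) : S.HM :=
  S.scale (S.sOf u) u

/-- `Ψ(u) = 𝒥(s_u u)`. -/
def Psi {N M : ℕ} (S : CompetitiveSystem N M) (u : S.HM) : ℝ :=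
  S.J (S.m u)

/-- The product `𝒯 = S_1 × ⋯ × S_M` of the unit spheres `S_i = {v ∈ H : ‖v‖_i = 1}`. -/
def T {N M : ℕ} (S : CompetitiveSystem N M) : Set S.HM :=
  {u | ∀ i, S.normI i (u i) = 1}

/-- The tangent space to `𝒯` at `u`. -/
def tangent {N M : ℕ} (S : CompetitiveSystem N M) (u : S.HM) : Set S.HM :=
  {v | ∀ i, S.innerI i (u i) (v i) = 0}

/-- The domain `𝒰` of `Ψ`. -/
def U {N M : ℕ} (S : CompetitiveSystem N M) : Set S.HM :=
  S.Utilde ∩ S.T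

/-- The boundary of `𝒰` in `𝒯`. -/
def boundaryU {N M : ℕ} (S : CompetitiveSystem N M) : Set S.HM :=
  Subtype.val '' frontier ((Subtype.val : S.T → S.HM) ⁻¹' S.U)

/-- The inverse of `𝔪 : 𝒰 → 𝒩`. -/
def mInv {N M : ℕ} (S : CompetitiveSystem N M) : S.HM → S.HM :=
  Function.invFunOn S.m S.U

/-- The derivative `Ψ'(u)`, for `u ∈ 𝒰`, as the derivative of `Ψ` within the subset `𝒰` of `ℋ`.
It is meaningful on the tangent space at `u` only, and it is evaluated only there. -/
def dPsi {N M : ℕ} (S : CompetitiveSystem N M) (u : S.HM) : S.HM →L[ℝ] ℝ :=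
  fderivWithin ℝ S.Psi S.U u

/-- The norm `sup {|f v| / ‖v‖ : v ∈ V, v ≠ 0}` of a functional on a subspace `V` of `ℋ`. -/
def dualNorm {N M : ℕ} (S : CompetitiveSystem N M) (V : Set S.HM) (f : S.HM →L[ℝ] ℝ) : ℝ≥0∞ :=
  ⨆ v ∈ V, ⨆ _ : v ≠ 0, ENNReal.ofReal (|f v| / S.hNorm v)

/-- `(u_n)` is a `(PS)_c`-sequence for `Ψ`. -/
def IsPSPsi {N M : ℕ} (S : CompetitiveSystem N M) (c : ℝ) (u : ℕ → S.HM) : Prop :=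
  (∀ n, u n ∈ S.U) ∧ Tendsto (fun n => S.Psi (u n)) atTop (𝓝 c) ∧
    Tendsto (fun n => S.dualNorm (S.tangent (u n)) (S.dPsi (u n))) atTop (𝓝 0)

/-- `(u_n)` is a `(PS)_c`-sequence for `𝒥`. -/
def IsPSJ {N M : ℕ} (S : CompetitiveSystem N M) (c : ℝ) (u : ℕ → S.HM) : Prop :=
  Tendsto (fun n => S.J (u n)) atTop (𝓝 c) ∧
    Tendsto (fun n => S.dualNorm Set.univ (fderiv ℝ S.J (u n))) atTop (𝓝 0)

end CompetitiveSystem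

end

/-! Put `s_i = e^{τ_i}` and divide the `i`-th Nehari equation of `su` by `s_i^p`. It becomes `A_i
e^{-(p-2)τ_i} - a_i + ∑_{j≠i} b_ij e^{α_ij(τ_j-τ_i)} = 0` with `A_i > 0` and `b_ij ≥ 0`, a finite
system with a maximum principle. Comparing two solutions at the index where their difference is
largest gives uniqueness of `s_u` (`eq_of_reducedNehari_eq_zero`). The same argument makes the
linearization in `τ` injective, so the implicit function theorem shows that `Utilde` is open and `u
↦ s_u` is C¹ (`exists_contDiffAt_reducedNehari_eq_zero`). This needs the coefficients to be only C¹
in `u`, not a second derivative of `J`.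

The coefficients and `J` are C¹ because the interactions are integrals of C¹ functions of the values
of `u`, homogeneous of degree `p`, and such integrals are C¹ on `L^p`
(`contDiff_integral_of_homogeneous`). Sobolev inequalities, or the assumed embedding, put `H` into
`L^p`.

At `m u` the derivative of `J` kills every vector `(c_1 u_1, …, c_M u_M)`. Hence the variation of
`s_u` drops out of `Ψ'` (`fderiv_Psi`), and testing `J'(m u)` on all of `ℋ` amounts to testing
`Ψ'(u)` on the tangent space, which gives the equivalence of critical points. Palais–Smale sequences
correspond because `s_u` is bounded below on `U` (`exists_sOf_ge`) and above on sublevel sets of `Ψ`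
(`exists_sOf_le`); the latter holds since `J` is a positive multiple of the squared norm on the
Nehari set. These two bounds also confine `s_u` to a compact box when `Ψ` stays bounded, so a limit
of such points in `𝒯` lies in `U` again and not on its boundary. -/

noncomputable section

/-! ### Growth and continuity estimates for homogeneous maps. -/

section Homogeneous

variable {E F : Type*} [NormedAddCommGroup E] [NormedSpace ℝ E]
  [NormedAddCommGroup F] [NormedSpace ℝ F]

theorem fderiv_smul_of_homogeneous {W : E → ℝ} {p : ℝ} (hW : Differentiable ℝ W)
    (hom : ∀ t : ℝ, 0 < t → ∀ y, W (t • y) = t ^ p * W y) {t : ℝ} (ht : 0 < t) (y : E) :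
    fderiv ℝ W (t • y) = t ^ (p - 1) • fderiv ℝ W y := by
  have h1 : HasFDerivAt (fun y => W (t • y)) (t • fderiv ℝ W (t • y)) y := by
    have := (hW (t • y)).hasFDerivAt.comp y ((hasFDerivAt_id y).const_smul t)
    refine this.congr_fderiv ?_
    ext v
    simp
  have h2 : HasFDerivAt (fun y => W (t • y)) (t ^ p • fderiv ℝ W y) y := by
    have : (fun y => W (t • y)) = fun y => t ^ p * W y := funext fun y => hom t ht y
    rw [this]
    exact (hW y).hasFDerivAt.const_mul (t ^ p)
  have h3 := h1.unique h2
  have h4 : fderiv ℝ W (t • y) = t⁻¹ • (t • fderiv ℝ W (t • y)) := by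
    rw [smul_smul, inv_mul_cancel₀ ht.ne', one_smul]
  rw [h4, h3, smul_smul, Real.rpow_sub_one ht.ne', div_eq_inv_mul]

theorem map_zero_of_homogeneous {G : E → F} {r : ℝ} (hr : 0 < r)
    (hom : ∀ t : ℝ, 0 < t → ∀ y, G (t • y) = t ^ r • G y) : G 0 = 0 := by
  have h := hom 2 two_pos 0
  rw [smul_zero] at h
  have h1 : ((2 : ℝ) ^ r - 1) • G 0 = 0 := by rw [sub_smul, one_smul, ← h, sub_self]
  have h2 : (1 : ℝ) < 2 ^ r := Real.one_lt_rpow one_lt_two hr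
  exact (smul_eq_zero.1 h1).resolve_left (by linarith)

theorem exists_bound_of_homogeneous [ProperSpace E] {G : E → F} {r : ℝ} (hr : 0 < r)
    (hG : Continuous G) (hom : ∀ t : ℝ, 0 < t → ∀ y, G (t • y) = t ^ r • G y) :
    ∃ C, 0 ≤ C ∧ ∀ y, ‖G y‖ ≤ C * ‖y‖ ^ r := by
  obtain ⟨C, hC⟩ := (isCompact_closedBall (0 : E) 1).exists_bound_of_continuousOn hG.continuousOn
  have hC0 : 0 ≤ C := (norm_nonneg _).trans (hC 0 (by simp))
  refine ⟨C, hC0, fun y => ?_⟩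
  rcases eq_or_ne y 0 with rfl | hy
  · rw [map_zero_of_homogeneous hr hom, norm_zero]
    positivity
  · have hy' : 0 < ‖y‖ := norm_pos_iff.2 hy
    have h : y = ‖y‖ • (‖y‖⁻¹ • y) := by rw [smul_smul, mul_inv_cancel₀ hy'.ne', one_smul]
    have h1 := hC (‖y‖⁻¹ • y) (by simp [norm_smul, inv_mul_cancel₀ hy'.ne'])
    rw [h, hom _ hy', ← h, norm_smul, Real.norm_of_nonneg (by positivity), mul_comm]
    gcongr

/-- Rescale by `‖z‖`. If `y` is close to `z` relative to `‖z‖`, uniform continuity on a fixed ball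
applies; otherwise `‖y‖` and `‖z‖` are both dominated by a multiple of `‖y - z‖`. Applied to the
derivative of the integrand, this replaces a dominated convergence argument. -/
theorem exists_modulus_of_homogeneous [ProperSpace E] {G : E → F} {r : ℝ} (hr : 0 < r)
    (hG : Continuous G) (hom : ∀ t : ℝ, 0 < t → ∀ y, G (t • y) = t ^ r • G y)
    {ε : ℝ} (hε : 0 < ε) :
    ∃ C, 0 ≤ C ∧ ∀ y z, ‖G y - G z‖ ≤ ε * ‖z‖ ^ r + C * ‖y - z‖ ^ r := by
  obtain ⟨C, hC0, hC⟩ := exists_bound_of_homogeneous hr hG hom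
  have huc := (isCompact_closedBall (0 : E) 2).uniformContinuousOn_of_continuous hG.continuousOn
  obtain ⟨δ₀, hδ₀, hδ⟩ := Metric.uniformContinuousOn_iff.1 huc ε hε
  -- Capping by 1 keeps the rescaled `y` in the ball of radius 2 around the origin.
  set δ := min δ₀ 1 with hδd
  have hδ0 : 0 < δ := lt_min hδ₀ one_pos
  have hK : 0 ≤ C * (1 + 1 / δ) ^ r + C * (1 / δ) ^ r := by positivity
  refine ⟨_, hK, fun y z => ?_⟩
  by_cases h : ‖y - z‖ < δ * ‖z‖
  · have hz : 0 < ‖z‖ := by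
      by_contra hz
      have : ‖z‖ = 0 := le_antisymm (not_lt.1 hz) (norm_nonneg _)
      rw [this, mul_zero] at h
      exact absurd h (not_lt.2 (norm_nonneg _))
    have e : ∀ w : E, w = ‖z‖ • (‖z‖⁻¹ • w) := fun w => by
      rw [smul_smul, mul_inv_cancel₀ hz.ne', one_smul]
    have hz1 : ‖‖z‖⁻¹ • z‖ = 1 := by simp [norm_smul, inv_mul_cancel₀ hz.ne']
    have hd : ‖‖z‖⁻¹ • y - ‖z‖⁻¹ • z‖ < δ := by
      rw [← smul_sub, norm_smul, norm_inv, norm_norm, inv_mul_lt_iff₀ hz, mul_comm]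
      exact h
    have hy1 : ‖‖z‖⁻¹ • y‖ ≤ 2 := by
      calc ‖‖z‖⁻¹ • y‖ = ‖(‖z‖⁻¹ • y - ‖z‖⁻¹ • z) + ‖z‖⁻¹ • z‖ := by rw [sub_add_cancel]
        _ ≤ δ + 1 := (norm_add_le _ _).trans (add_le_add hd.le hz1.le)
        _ ≤ 2 := by linarith [min_le_right δ₀ (1 : ℝ)]
    have h1 := hδ (‖z‖⁻¹ • y) (by simpa using hy1) (‖z‖⁻¹ • z)
      (by simp only [Metric.mem_closedBall, dist_zero_right]; linarith)
      (by rw [dist_eq_norm]; exact hd.trans_le (min_le_left _ _))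
    rw [dist_eq_norm] at h1
    have h2 : G y - G z = ‖z‖ ^ r • (G (‖z‖⁻¹ • y) - G (‖z‖⁻¹ • z)) := by
      rw [smul_sub, ← hom _ hz, ← hom _ hz, ← e, ← e]
    rw [h2, norm_smul, Real.norm_of_nonneg (by positivity), mul_comm]
    have h3 : ‖G (‖z‖⁻¹ • y) - G (‖z‖⁻¹ • z)‖ * ‖z‖ ^ r ≤ ε * ‖z‖ ^ r := by gcongr
    have h4 : 0 ≤ (C * (1 + 1 / δ) ^ r + C * (1 / δ) ^ r) * ‖y - z‖ ^ r := by positivity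
    linarith
  · have hz : ‖z‖ ≤ 1 / δ * ‖y - z‖ := by
      rw [one_div, ← div_eq_inv_mul, le_div_iff₀ hδ0, mul_comm]
      exact not_lt.1 h
    have hy : ‖y‖ ≤ (1 + 1 / δ) * ‖y - z‖ := by
      have := norm_add_le (y - z) z
      rw [sub_add_cancel] at this
      linarith
    have h1 : ‖G y‖ ≤ C * (1 + 1 / δ) ^ r * ‖y - z‖ ^ r := by
      refine (hC y).trans ?_
      rw [mul_assoc, ← Real.mul_rpow (by positivity) (norm_nonneg _)]
      gcongr
    have h2 : ‖G z‖ ≤ C * (1 / δ) ^ r * ‖y - z‖ ^ r := by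
      refine (hC z).trans ?_
      rw [mul_assoc, ← Real.mul_rpow (by positivity) (norm_nonneg _)]
      gcongr
    have h3 : 0 ≤ ε * ‖z‖ ^ r := by positivity
    have h4 := norm_sub_le (G y) (G z)
    linarith

end Homogeneous

/-! ### Integral functionals of homogeneous integrands on `L^p`. -/

section LpIntegral

variable {X : Type*} [MeasurableSpace X] {ν : Measure X}
variable {E : Type*} [NormedAddCommGroup E] {p : ℝ}

theorem MeasureTheory.Lp.integrable_norm_rpow (hp : 1 < p) (u : Lp E (ENNReal.ofReal p) ν) :
    Integrable (fun x => ‖u x‖ ^ p) ν := by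
  have := (Lp.memLp u).integrable_norm_rpow (by simpa using by linarith) ENNReal.ofReal_ne_top
  rwa [ENNReal.toReal_ofReal (by linarith)] at this

theorem MeasureTheory.Lp.integral_norm_rpow (hp : 1 < p) (u : Lp E (ENNReal.ofReal p) ν) :
    ∫ x, ‖u x‖ ^ p ∂ν = ‖u‖ ^ p := by
  have h0 : 0 < p := by linarith
  rw [Lp.norm_def, (Lp.memLp u).eLpNorm_eq_integral_rpow_norm (by simpa using h0)
    ENNReal.ofReal_ne_top, ENNReal.toReal_ofReal h0.le, ENNReal.toReal_ofReal (by positivity),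
    ← Real.rpow_mul (integral_nonneg fun x => by positivity), inv_mul_cancel₀ h0.ne',
    Real.rpow_one]

theorem MeasureTheory.Lp.holder_norm_rpow [Fact (1 ≤ ENNReal.ofReal p)] (hp : 1 < p)
    (u h : Lp E (ENNReal.ofReal p) ν) :
    Integrable (fun x => ‖u x‖ ^ (p - 1) * ‖h x‖) ν ∧
      ∫ x, ‖u x‖ ^ (p - 1) * ‖h x‖ ∂ν ≤ ‖u‖ ^ (p - 1) * ‖h‖ := by
  have h0 : 0 < p := by linarith
  have h1 : 0 < p - 1 := by linarith
  have hc : (p / (p - 1)).HolderConjugate p := (Real.HolderConjugate.conjExponent hp).symm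
  have hm : MemLp (fun x => ‖u x‖ ^ (p - 1)) (ENNReal.ofReal (p / (p - 1))) ν := by
    have := (Lp.memLp u).norm_rpow_div (ENNReal.ofReal (p - 1))
    rwa [ENNReal.toReal_ofReal h1.le, ← ENNReal.ofReal_div_of_pos h1] at this
  have hh : MemLp (fun x => ‖h x‖) (ENNReal.ofReal p) ν := (Lp.memLp h).norm
  constructor
  · have : ENNReal.HolderConjugate (ENNReal.ofReal (p / (p - 1))) (ENNReal.ofReal p) :=
      hc.ennrealOfReal
    exact hm.integrable_mul hh
  · have := integral_mul_le_Lp_mul_Lq_of_nonneg hc (Eventually.of_forall fun x => by positivity)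
      (Eventually.of_forall fun x => norm_nonneg _) hm hh
    refine this.trans (le_of_eq ?_)
    congr 1
    · have : (fun x => (‖u x‖ ^ (p - 1)) ^ (p / (p - 1))) = fun x => ‖u x‖ ^ p := by
        funext x
        rw [← Real.rpow_mul (norm_nonneg _), mul_div_cancel₀ _ h1.ne']
      rw [this, integral_norm_rpow hp, ← Real.rpow_mul (norm_nonneg _)]
      congr 1
      field_simp
    · rw [integral_norm_rpow hp, ← Real.rpow_mul (norm_nonneg _), mul_one_div_cancel h0.ne',
        Real.rpow_one]

variable [NormedSpace ℝ E] [FiniteDimensional ℝ E] [Fact (1 ≤ ENNReal.ofReal p)]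

/-- The derivative of `W` is homogeneous of degree `p - 1`, so Hölder's inequality makes `h ↦ ∫
W'(u) h` bounded on `L^p`. The homogeneous modulus of continuity of `W'`, integrated with Hölder
again, controls both the Taylor remainder and the continuity of the derivative in `u`. -/
theorem contDiff_integral_of_homogeneous (hp : 1 < p) {W : E → ℝ} (hW : ContDiff ℝ 1 W)
    (hom : ∀ t : ℝ, 0 < t → ∀ y, W (t • y) = t ^ p * W y) :
    ContDiff ℝ 1 (fun u : Lp E (ENNReal.ofReal p) ν => ∫ x, W (u x) ∂ν) := by
  have : ProperSpace E := FiniteDimensional.proper_real E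
  have h1 : 0 < p - 1 := by linarith
  have hd : Differentiable ℝ W := hW.differentiable one_ne_zero
  have hKc : Continuous (fderiv ℝ W) := hW.continuous_fderiv one_ne_zero
  have hKh : ∀ t : ℝ, 0 < t → ∀ y, fderiv ℝ W (t • y) = t ^ (p - 1) • fderiv ℝ W y :=
    fun t ht y => fderiv_smul_of_homogeneous hd hom ht y
  obtain ⟨C, hC0, hC⟩ := exists_bound_of_homogeneous h1 hKc hKh
  obtain ⟨D, hD0, hD⟩ := exists_bound_of_homogeneous (by linarith : 0 < p) hW.continuous
    (fun t ht y => (hom t ht y).trans (smul_eq_mul _ _).symm)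
  have hWi : ∀ u : Lp E (ENNReal.ofReal p) ν, Integrable (fun x => W (u x)) ν := fun u =>
    ((Lp.integrable_norm_rpow hp u).const_mul D).mono'
      (hW.continuous.comp_aestronglyMeasurable (Lp.aestronglyMeasurable u))
      (Eventually.of_forall fun x => hD _)
  have hKm : ∀ u h : Lp E (ENNReal.ofReal p) ν,
      AEStronglyMeasurable (fun x => fderiv ℝ W (u x) (h x)) ν := fun u h =>
    (isBoundedBilinearMap_apply.continuous.comp
      (hKc.prodMap continuous_id)).comp_aestronglyMeasurable
      ((Lp.aestronglyMeasurable u).prodMk (Lp.aestronglyMeasurable h))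
  have hKb : ∀ u h : Lp E (ENNReal.ofReal p) ν, ∀ x,
      ‖fderiv ℝ W (u x) (h x)‖ ≤ C * (‖u x‖ ^ (p - 1) * ‖h x‖) := fun u h x => by
    refine ((fderiv ℝ W (u x)).le_opNorm _).trans ?_
    rw [← mul_assoc]
    gcongr
    exact hC _
  have hKi : ∀ u h : Lp E (ENNReal.ofReal p) ν,
      Integrable (fun x => fderiv ℝ W (u x) (h x)) ν := fun u h =>
    ((Lp.holder_norm_rpow hp u h).1.const_mul C).mono' (hKm u h) (Eventually.of_forall (hKb u h))
  let G : Lp E (ENNReal.ofReal p) ν → Lp E (ENNReal.ofReal p) ν →L[ℝ] ℝ := fun u =>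
    LinearMap.mkContinuous
      { toFun := fun h => ∫ x, fderiv ℝ W (u x) (h x) ∂ν
        map_add' := fun h k => by
          rw [← integral_add (hKi u h) (hKi u k)]
          refine integral_congr_ae ?_
          filter_upwards [Lp.coeFn_add h k] with x hx
          rw [hx, Pi.add_apply, map_add]
        map_smul' := fun c h => by
          rw [RingHom.id_apply, smul_eq_mul, ← integral_const_mul]
          refine integral_congr_ae ?_
          filter_upwards [Lp.coeFn_smul c h] with x hx
          rw [hx, Pi.smul_apply, map_smul, smul_eq_mul] }
      (C * ‖u‖ ^ (p - 1)) (fun h => by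
        refine (norm_integral_le_of_norm_le ((Lp.holder_norm_rpow hp u h).1.const_mul C)
          (Eventually.of_forall (hKb u h))).trans ?_
        rw [integral_const_mul, mul_assoc]
        gcongr
        exact (Lp.holder_norm_rpow hp u h).2)
  have hG : ∀ u h, G u h = ∫ x, fderiv ℝ W (u x) (h x) ∂ν := fun u h => rfl
  have hderiv : ∀ u,
      HasFDerivAt (fun u : Lp E (ENNReal.ofReal p) ν => ∫ x, W (u x) ∂ν) (G u) u := by
    intro u
    rw [hasFDerivAt_iff_isLittleO_nhds_zero, Asymptotics.isLittleO_iff]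
    intro c hc
    -- Chosen so that `ε ‖u‖^(p-1) ≤ c/2`; the added 1 covers `u = 0`. The other half of `c` pays
    -- for the term in `‖h‖^(p-1)`.
    set ε := c / (2 * (‖u‖ ^ (p - 1) + 1)) with hε
    have hu0 : 0 ≤ ‖u‖ ^ (p - 1) := by positivity
    have hε0 : 0 < ε := by positivity
    obtain ⟨K, hK0, hK⟩ := exists_modulus_of_homogeneous h1 hKc hKh hε0
    have hsmall : ∀ᶠ h : Lp E (ENNReal.ofReal p) ν in 𝓝 0, K * ‖h‖ ^ (p - 1) < c / 2 := by
      have : Continuous fun h : Lp E (ENNReal.ofReal p) ν => K * ‖h‖ ^ (p - 1) :=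
        continuous_const.mul (continuous_norm.rpow_const fun _ => Or.inr h1.le)
      refine this.continuousAt.eventually_lt_const ?_
      beta_reduce
      rw [norm_zero, Real.zero_rpow h1.ne', mul_zero]
      positivity
    filter_upwards [hsmall] with h hh
    have hb : ∀ y k : E, ‖W (y + k) - W y - fderiv ℝ W y k‖ ≤
        ε * (‖y‖ ^ (p - 1) * ‖k‖) + K * (‖k‖ ^ (p - 1) * ‖k‖) := by
      intro y k
      -- Mean value inequality for `W` minus its linearization at `y`, along the segment from `y` to
      -- `y + k`.
      have := Convex.norm_image_sub_le_of_norm_hasFDerivWithin_le'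
        (f := W) (f' := fderiv ℝ W) (φ := fderiv ℝ W y) (s := segment ℝ y (y + k))
        (C := ε * ‖y‖ ^ (p - 1) + K * ‖k‖ ^ (p - 1))
        (fun z _ => (hd z).hasFDerivAt.hasFDerivWithinAt)
        (fun z hz => by
          refine (hK z y).trans ?_
          have : ‖z - y‖ ≤ ‖k‖ := by
            have := norm_sub_le_of_mem_segment hz
            rwa [add_sub_cancel_left] at this
          gcongr) (convex_segment _ _) (left_mem_segment ℝ _ _) (right_mem_segment ℝ _ _)
      rw [add_sub_cancel_left] at this
      linarith
    have e1 : (∫ x, W ((u + h : Lp E (ENNReal.ofReal p) ν) x) ∂ν) - (∫ x, W (u x) ∂ν) - G u h =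
        ∫ x, (W (u x + h x) - W (u x) - fderiv ℝ W (u x) (h x)) ∂ν := by
      have e2 : (∫ x, W ((u + h : Lp E (ENNReal.ofReal p) ν) x) ∂ν) = ∫ x, W (u x + h x) ∂ν := by
        refine integral_congr_ae ?_
        filter_upwards [Lp.coeFn_add u h] with x hx
        rw [hx, Pi.add_apply]
      have i2 : Integrable (fun x => W (u x + h x)) ν := by
        refine (hWi (u + h)).congr ?_
        filter_upwards [Lp.coeFn_add u h] with x hx
        rw [hx, Pi.add_apply]
      have := integral_sub (i2.sub (hWi u)) (hKi u h)
      simp only [Pi.sub_apply] at this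
      rw [this, integral_sub i2 (hWi u), hG, e2]
    rw [e1]
    obtain ⟨j1, k1⟩ := Lp.holder_norm_rpow hp u h
    obtain ⟨j2, k2⟩ := Lp.holder_norm_rpow hp h h
    refine (norm_integral_le_of_norm_le ((j1.const_mul ε).add (j2.const_mul K))
      (Eventually.of_forall fun x => hb (u x) (h x))).trans ?_
    simp only [Pi.add_apply]
    rw [integral_add (j1.const_mul ε) (j2.const_mul K), integral_const_mul, integral_const_mul]
    have h5 : ε * ‖u‖ ^ (p - 1) ≤ c / 2 := by
      rw [hε, div_mul_eq_mul_div, div_le_div_iff₀ (by positivity) two_pos]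
      nlinarith
    calc _ ≤ ε * (‖u‖ ^ (p - 1) * ‖h‖) + K * (‖h‖ ^ (p - 1) * ‖h‖) := by gcongr
      _ = (ε * ‖u‖ ^ (p - 1) + K * ‖h‖ ^ (p - 1)) * ‖h‖ := by ring
      _ ≤ (c / 2 + c / 2) * ‖h‖ := by gcongr
      _ = c * ‖h‖ := by ring
  have hcont : Continuous G := by
    rw [continuous_iff_continuousAt]
    intro u
    rw [ContinuousAt, Metric.tendsto_nhds]
    intro c hc
    set ε := c / (2 * (‖u‖ ^ (p - 1) + 1)) with hε
    have hu0 : 0 ≤ ‖u‖ ^ (p - 1) := by positivity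
    have hε0 : 0 < ε := by positivity
    obtain ⟨K, hK0, hK⟩ := exists_modulus_of_homogeneous h1 hKc hKh hε0
    have hsmall : ∀ᶠ w : Lp E (ENNReal.ofReal p) ν in 𝓝 u, K * ‖w - u‖ ^ (p - 1) < c / 2 := by
      have : Continuous fun w : Lp E (ENNReal.ofReal p) ν => K * ‖w - u‖ ^ (p - 1) :=
        continuous_const.mul ((continuous_id.sub continuous_const).norm.rpow_const
          fun _ => Or.inr h1.le)
      refine this.continuousAt.eventually_lt_const ?_
      beta_reduce
      rw [sub_self, norm_zero, Real.zero_rpow h1.ne', mul_zero]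
      positivity
    filter_upwards [hsmall] with w hw
    rw [dist_eq_norm]
    have h5 : ε * ‖u‖ ^ (p - 1) < c / 2 := by
      rw [hε, div_mul_eq_mul_div, div_lt_div_iff₀ (by positivity) two_pos]
      nlinarith
    refine lt_of_le_of_lt (ContinuousLinearMap.opNorm_le_bound _
      (M := ε * ‖u‖ ^ (p - 1) + K * ‖w - u‖ ^ (p - 1)) (by positivity) fun h => ?_) (by linarith)
    rw [sub_apply, hG, hG, ← integral_sub (hKi w h) (hKi u h)]
    obtain ⟨j1, k1⟩ := Lp.holder_norm_rpow hp u h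
    obtain ⟨j2, k2⟩ := Lp.holder_norm_rpow hp (w - u) h
    refine (norm_integral_le_of_norm_le ((j1.const_mul ε).add (j2.const_mul K)) ?_).trans ?_
    · filter_upwards [Lp.coeFn_sub w u] with x hx
      rw [Pi.add_apply, hx, Pi.sub_apply, ← sub_apply]
      refine ((fderiv ℝ W (w x) - fderiv ℝ W (u x)).le_opNorm _).trans ?_
      rw [← mul_assoc, ← mul_assoc, ← add_mul]
      gcongr
      exact hK _ _
    · simp only [Pi.add_apply]
      rw [integral_add (j1.const_mul ε) (j2.const_mul K), integral_const_mul, integral_const_mul]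
      calc _ ≤ ε * (‖u‖ ^ (p - 1) * ‖h‖) + K * (‖w - u‖ ^ (p - 1) * ‖h‖) := by gcongr
        _ = _ := by ring
  rw [contDiff_one_iff_fderiv]
  refine ⟨fun u => (hderiv u).differentiableAt, ?_⟩
  rwa [funext fun u => (hderiv u).fderiv]

end LpIntegral

/-! ### Sobolev inequalities for test functions in every dimension. -/

section Sobolev

/-- Interpolation by splitting at height `D`: below it `|f|^p ≤ D^(p-2) |f|^2`, above it `|f|^p ≤
D^(p-r) |f|^r`. -/
theorem MeasureTheory.eLpNorm_le_of_eLpNorm_two_of_eLpNorm {X F : Type*} [MeasurableSpace X]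
    [NormedAddCommGroup F] {ν : Measure X} {f : X → F} (hf : AEStronglyMeasurable f ν)
    {p r : ℝ} (h2 : 2 ≤ p) (hr : p ≤ r) {D : ℝ≥0∞} (hD2 : eLpNorm f 2 ν ≤ D)
    (hDr : eLpNorm f (ENNReal.ofReal r) ν ≤ D) :
    eLpNorm f (ENNReal.ofReal p) ν ≤ 2 * D := by
  have hp0 : 0 < p := by linarith
  have hr0 : 0 < r := by linarith
  rcases eq_or_ne D 0 with rfl | hD0
  · have : f =ᵐ[ν] 0 := (eLpNorm_eq_zero_iff hf two_ne_zero).1 (le_antisymm hD2 bot_le)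
    rw [eLpNorm_congr_ae this]
    simp
  rcases eq_or_ne D ∞ with rfl | hDt
  · simp
  have key : ∀ x, ‖f x‖ₑ ^ p ≤ D ^ (p - 2) * ‖f x‖ₑ ^ (2 : ℝ) + D ^ (p - r) * ‖f x‖ₑ ^ r := by
    intro x
    rcases le_total ‖f x‖ₑ D with h | h
    · refine le_trans ?_ le_self_add
      calc ‖f x‖ₑ ^ p = ‖f x‖ₑ ^ (p - 2) * ‖f x‖ₑ ^ (2 : ℝ) := by
            rw [← ENNReal.rpow_add_of_nonneg _ _ (by linarith) (by norm_num), sub_add_cancel]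
        _ ≤ _ := by gcongr
    · refine le_trans ?_ le_add_self
      have h0 : ‖f x‖ₑ ≠ 0 := fun h0 => hD0 (le_antisymm (h0 ▸ h) bot_le)
      calc ‖f x‖ₑ ^ p = ‖f x‖ₑ ^ (p - r) * ‖f x‖ₑ ^ r := by
            rw [← ENNReal.rpow_add _ _ h0 enorm_ne_top, sub_add_cancel]
        _ ≤ _ := by
            gcongr ?_ * _
            rw [← neg_sub, ENNReal.rpow_neg, ENNReal.rpow_neg]
            exact ENNReal.inv_le_inv.2 (ENNReal.rpow_le_rpow h (by linarith))
  have e2 : ∫⁻ x, ‖f x‖ₑ ^ (2 : ℝ) ∂ν ≤ D ^ (2 : ℝ) := by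
    have := eLpNorm_eq_lintegral_rpow_enorm_toReal (μ := ν) (f := f) two_ne_zero
      ENNReal.ofNat_ne_top
    rw [this, ENNReal.toReal_ofNat, one_div, ENNReal.rpow_inv_le_iff two_pos] at hD2
    exact hD2
  have er : ∫⁻ x, ‖f x‖ₑ ^ r ∂ν ≤ D ^ r := by
    have := eLpNorm_eq_lintegral_rpow_enorm_toReal (μ := ν) (f := f)
      (p := ENNReal.ofReal r) (by simpa using hr0) ENNReal.ofReal_ne_top
    rw [this, ENNReal.toReal_ofReal hr0.le, one_div, ENNReal.rpow_inv_le_iff hr0] at hDr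
    exact hDr
  rw [eLpNorm_eq_lintegral_rpow_enorm_toReal (by simpa using hp0) ENNReal.ofReal_ne_top,
    ENNReal.toReal_ofReal hp0.le, one_div, ENNReal.rpow_inv_le_iff hp0]
  have hm : ∀ t : ℝ, AEMeasurable (fun x => ‖f x‖ₑ ^ t) ν := fun t => hf.enorm.pow_const t
  calc ∫⁻ x, ‖f x‖ₑ ^ p ∂ν
      ≤ ∫⁻ x, (D ^ (p - 2) * ‖f x‖ₑ ^ (2 : ℝ) + D ^ (p - r) * ‖f x‖ₑ ^ r) ∂ν :=
        lintegral_mono key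
    _ = D ^ (p - 2) * ∫⁻ x, ‖f x‖ₑ ^ (2 : ℝ) ∂ν + D ^ (p - r) * ∫⁻ x, ‖f x‖ₑ ^ r ∂ν := by
        rw [lintegral_add_left' ((hm 2).const_mul _), lintegral_const_mul'' _ (hm 2),
          lintegral_const_mul'' _ (hm r)]
    _ ≤ D ^ (p - 2) * D ^ (2 : ℝ) + D ^ (p - r) * D ^ r := by gcongr
    _ = 2 * D ^ p := by
        rw [← ENNReal.rpow_add _ _ hD0 hDt, ← ENNReal.rpow_add _ _ hD0 hDt, sub_add_cancel,
          sub_add_cancel, two_mul]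
    _ ≤ (2 * D) ^ p := by
        rw [ENNReal.mul_rpow_of_nonneg _ _ hp0.le]
        gcongr
        calc (2 : ℝ≥0∞) = 2 ^ (1 : ℝ) := by rw [ENNReal.rpow_one]
          _ ≤ 2 ^ p := ENNReal.rpow_le_rpow_of_exponent_le (by norm_num) (by linarith)

theorem MeasureTheory.eLpNorm_le_of_eLpNorm_two_of_bound {X F : Type*} [MeasurableSpace X]
    [NormedAddCommGroup F] {ν : Measure X} {f : X → F}
    {p : ℝ} (h2 : 2 ≤ p) {D : ℝ≥0∞} (hD2 : eLpNorm f 2 ν ≤ D)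
    (hD : ∀ x, ‖f x‖ₑ ≤ D) :
    eLpNorm f (ENNReal.ofReal p) ν ≤ D := by
  have hp0 : 0 < p := by linarith
  rcases eq_or_ne D ∞ with rfl | hDt
  · simp
  have e2 : ∫⁻ x, ‖f x‖ₑ ^ (2 : ℝ) ∂ν ≤ D ^ (2 : ℝ) := by
    have := eLpNorm_eq_lintegral_rpow_enorm_toReal (μ := ν) (f := f) two_ne_zero
      ENNReal.ofNat_ne_top
    rw [this, ENNReal.toReal_ofNat, one_div, ENNReal.rpow_inv_le_iff two_pos] at hD2
    exact hD2
  rw [eLpNorm_eq_lintegral_rpow_enorm_toReal (by simpa using hp0) ENNReal.ofReal_ne_top,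
    ENNReal.toReal_ofReal hp0.le, one_div, ENNReal.rpow_inv_le_iff hp0]
  calc ∫⁻ x, ‖f x‖ₑ ^ p ∂ν
      ≤ ∫⁻ x, (D ^ (p - 2) * ‖f x‖ₑ ^ (2 : ℝ)) ∂ν := lintegral_mono fun x => by
        calc ‖f x‖ₑ ^ p = ‖f x‖ₑ ^ (p - 2) * ‖f x‖ₑ ^ (2 : ℝ) := by
              rw [← ENNReal.rpow_add_of_nonneg _ _ (by linarith) (by norm_num), sub_add_cancel]
          _ ≤ _ := mul_le_mul_left (ENNReal.rpow_le_rpow (hD x) (by linarith)) _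
    _ = D ^ (p - 2) * ∫⁻ x, ‖f x‖ₑ ^ (2 : ℝ) ∂ν :=
        lintegral_const_mul' _ _ (ENNReal.rpow_ne_top_of_nonneg (by linarith) hDt)
    _ ≤ D ^ (p - 2) * D ^ (2 : ℝ) := by gcongr
    _ = D ^ p := by
        rw [← ENNReal.rpow_add_of_nonneg _ _ (by linarith) (by norm_num), sub_add_cancel]

theorem HasCompactSupport.pow_succ {E : Type*} [TopologicalSpace E] {φ : E → ℝ}
    (h : HasCompactSupport φ) (k : ℕ) : HasCompactSupport (fun x => φ x ^ (k + 1)) :=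
  h.comp_left (g := fun t : ℝ => t ^ (k + 1)) (by simp)

variable {E : Type*} [NormedAddCommGroup E] [NormedSpace ℝ E] [MeasurableSpace E] [BorelSpace E]
  [FiniteDimensional ℝ E]

theorem eLpNorm_one_fderiv_pow_le (ν : Measure E) {φ : E → ℝ} (hφ : ContDiff ℝ 1 φ) (k : ℕ) :
    eLpNorm (fderiv ℝ (fun x => φ x ^ (k + 1))) 1 ν ≤
      (k + 1 : ℕ) * (eLpNorm (fun x => φ x ^ k) 2 ν * eLpNorm (fderiv ℝ φ) 2 ν) := by
  have e : ∀ x, ‖fderiv ℝ (fun x => φ x ^ (k + 1)) x‖₊ ≤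
      ((k + 1 : ℕ) : NNReal) * ‖(fun x => φ x ^ k • fderiv ℝ φ x) x‖₊ := by
    intro x
    rw [fderiv_fun_pow _ (hφ.differentiable one_ne_zero x), add_tsub_cancel_right, nsmul_eq_mul,
      mul_smul, nnnorm_smul, ← NNReal.coe_le_coe, NNReal.coe_mul, NNReal.coe_mul, coe_nnnorm,
      Real.norm_natCast, NNReal.coe_natCast]
  refine (eLpNorm_le_nnreal_smul_eLpNorm_of_ae_le_mul (Eventually.of_forall e) 1).trans ?_
  rw [ENNReal.smul_def, smul_eq_mul, ENNReal.coe_natCast]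
  have h : eLpNorm ((fun x => φ x ^ k) • fderiv ℝ φ) 1 ν ≤
      eLpNorm (fun x => φ x ^ k) 2 ν * eLpNorm (fderiv ℝ φ) 2 ν :=
    eLpNorm_smul_le_mul_eLpNorm (p := 2) (q := 2) (r := 1)
      (hφ.continuous_fderiv one_ne_zero).aestronglyMeasurable
      (hφ.continuous.pow k).aestronglyMeasurable
  exact mul_le_mul_right h _

/-- In dimension two the gradient in `L¹` controls the function in `L²`. Applied to successive
powers of `φ`, with Cauchy–Schwarz on `φ^k ∇φ`, this bounds `φ` in arbitrarily high even exponents;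
interpolation with `L²` gives the rest. -/
theorem exists_sobolev_dim_two (hE : Module.finrank ℝ E = 2) (ν : Measure E) [ν.IsAddHaarMeasure]
    {p : ℝ} (hp : 2 ≤ p) : ∃ C : NNReal, ∀ φ : E → ℝ, ContDiff ℝ 1 φ → HasCompactSupport φ →
      eLpNorm φ (ENNReal.ofReal p) ν ≤ C * (eLpNorm φ 2 ν + eLpNorm (fderiv ℝ φ) 2 ν) := by
  set C := eLpNormLESNormFDerivOneConst ν 2 with hC
  have step : ∀ φ : E → ℝ, ContDiff ℝ 1 φ → HasCompactSupport φ → ∀ k : ℕ,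
      eLpNorm (fun x => φ x ^ (k + 1)) 2 ν ≤
        C ^ k * (k + 1).factorial * (eLpNorm φ 2 ν * eLpNorm (fderiv ℝ φ) 2 ν ^ k) := by
    intro φ h1 h2 k
    induction k with
    | zero => simp
    | succ k ih =>
      have hconj : NNReal.HolderConjugate (Module.finrank ℝ E : NNReal) 2 := by
        rw [hE]
        constructor <;> norm_num
      have h := eLpNorm_le_eLpNorm_fderiv_one ν (h1.pow (k + 1 + 1)) (h2.pow_succ (k + 1)) hconj
      refine h.trans ?_
      calc _ ≤ C * ((k + 1 + 1 : ℕ) * ((C ^ k * (k + 1).factorial *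
            (eLpNorm φ 2 ν * eLpNorm (fderiv ℝ φ) 2 ν ^ k)) * eLpNorm (fderiv ℝ φ) 2 ν)) := by
            refine mul_le_mul' (by simp [hC]) ((eLpNorm_one_fderiv_pow_le ν h1 (k + 1)).trans ?_)
            gcongr
        _ = _ := by
            rw [Nat.factorial_succ (k + 1)]
            push_cast
            ring
  obtain ⟨k, hk⟩ := exists_nat_ge p
  set A : NNReal := C ^ k * (k + 1).factorial with hA
  -- The `L²` norm of `φ^n` is the `n`-th power of the `L^{2n}` norm of `φ`, and `2n ≥ p` because `k
  -- ≥ p`.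
  set n : ℝ := ((k + 1 : ℕ) : ℝ) with hn
  have hn0 : 0 < n := by positivity
  refine ⟨2 * (A ^ n⁻¹ + 1), fun φ h1 h2 => ?_⟩
  set D := eLpNorm φ 2 ν + eLpNorm (fderiv ℝ φ) 2 ν with hD
  have hr : eLpNorm φ (ENNReal.ofReal (2 * n)) ν ≤ A ^ n⁻¹ * D := by
    have h3 := step φ h1 h2 k
    have h4 : eLpNorm (fun x => φ x ^ (k + 1)) 2 ν = eLpNorm φ (ENNReal.ofReal (2 * n)) ν ^ n := by
      rw [ENNReal.ofReal_mul zero_le_two, ENNReal.ofReal_ofNat, ← eLpNorm_norm_rpow φ hn0]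
      refine eLpNorm_congr_norm_ae (Eventually.of_forall fun x => ?_)
      rw [hn, Real.rpow_natCast, norm_pow, norm_pow, norm_norm]
    have h5 : eLpNorm φ (ENNReal.ofReal (2 * n)) ν ^ n ≤ (A ^ n⁻¹ * D) ^ n := by
      rw [← h4]
      refine h3.trans ?_
      rw [ENNReal.mul_rpow_of_nonneg _ _ hn0.le, ← ENNReal.rpow_mul, inv_mul_cancel₀ hn0.ne',
        ENNReal.rpow_one, hn, ENNReal.rpow_natCast, _root_.pow_succ' D, hA]
      push_cast
      gcongr
      · exact le_self_add
      · exact le_add_self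
    exact (ENNReal.rpow_le_rpow_iff hn0).1 h5
  have h6 := eLpNorm_le_of_eLpNorm_two_of_eLpNorm (ν := ν) (f := φ)
    h1.continuous.aestronglyMeasurable hp (r := 2 * n) (by rw [hn]; push_cast; linarith)
    (D := (A ^ n⁻¹ + 1) * D)
    (by rw [add_mul, one_mul]; exact le_self_add.trans le_add_self)
    (by rw [add_mul, one_mul]; exact hr.trans le_self_add)
  refine h6.trans (le_of_eq ?_)
  push_cast
  rw [ENNReal.coe_rpow_of_nonneg _ (by positivity), mul_assoc]

/-- Integrating the derivative of `φ²` over a half-line gives `φ(x)² ≤ 2 ‖φ‖₂ ‖φ'‖₂`, a uniform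
bound, which interpolates with the `L²` norm. -/
theorem exists_sobolev_dim_one {p : ℝ} (hp : 2 ≤ p) : ∃ C : NNReal,
    ∀ φ : EuclideanSpace ℝ (Fin 1) → ℝ, ContDiff ℝ 1 φ → HasCompactSupport φ →
      eLpNorm φ (ENNReal.ofReal p) volume ≤
        C * (eLpNorm φ 2 volume + eLpNorm (fderiv ℝ φ) 2 volume) := by
  refine ⟨2, fun φ h1 h2 => ?_⟩
  set D := eLpNorm φ 2 volume + eLpNorm (fderiv ℝ φ) 2 volume with hD
  have hD2 : D ≤ (2 : NNReal) * D := by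
    rw [ENNReal.coe_ofNat, two_mul]
    exact le_self_add
  refine eLpNorm_le_of_eLpNorm_two_of_bound hp (le_trans le_self_add hD2) fun x => ?_
  let e : ℝ ≃ₗᵢ[ℝ] EuclideanSpace ℝ (Fin 1) := (OrthonormalBasis.singleton (Fin 1) ℝ).repr
  have hmp : MeasurePreserving e volume volume := e.measurePreserving
  have hg : ContDiff ℝ 1 (fun y => φ (e y) ^ 2) := (h1.comp e.contDiff).pow 2
  have hgs : HasCompactSupport (fun y => φ (e y) ^ 2) :=
    (h2.comp_homeomorph e.toHomeomorph).pow_succ 1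
  have hle := hgs.enorm_le_lintegral_Ici_deriv hg (e.symm x)
  rw [e.apply_symm_apply] at hle
  have hpt : ∀ y, ‖deriv (fun y => φ (e y) ^ 2) y‖ₑ ≤ ‖fderiv ℝ (fun x => φ x ^ 2) (e y)‖ₑ := by
    intro y
    have hd : HasDerivAt (fun y => φ (e y) ^ 2) (fderiv ℝ (fun x => φ x ^ 2) (e y) (e 1)) y := by
      have h3 : HasFDerivAt (fun x => φ x ^ 2) (fderiv ℝ (fun x => φ x ^ 2) (e y)) (e y) :=
        ((h1.pow 2).differentiable one_ne_zero (e y)).hasFDerivAt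
      have h4 : HasDerivAt (fun y => e y) (e 1) y := by
        have := (e.toContinuousLinearEquiv.toContinuousLinearMap).hasDerivAt (x := y)
        exact this
      exact h3.comp_hasDerivAt y h4
    rw [hd.deriv]
    refine ((fderiv ℝ (fun x => φ x ^ 2) (e y)).le_opENorm _).trans (le_of_eq ?_)
    rw [e.enorm_map, enorm_one, mul_one]
  have hint : ∫⁻ y in Iic (e.symm x), ‖deriv (fun y => φ (e y) ^ 2) y‖ₑ ≤
      eLpNorm (fderiv ℝ (fun x => φ x ^ 2)) 1 volume := by
    rw [eLpNorm_one_eq_lintegral_enorm]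
    calc _ ≤ ∫⁻ y, ‖fderiv ℝ (fun x => φ x ^ 2) (e y)‖ₑ :=
          (setLIntegral_le_lintegral _ _).trans (lintegral_mono hpt)
      _ = _ := hmp.lintegral_comp
          (((h1.pow 2).continuous_fderiv one_ne_zero).measurable.enorm)
  have h5 := hle.trans (hint.trans (eLpNorm_one_fderiv_pow_le volume h1 1))
  simp only [pow_one] at h5
  -- The bound `2 D²` is weakened to a perfect square so that the square root can be taken.
  have h6 : ‖φ x‖ₑ ^ 2 ≤ (2 * D) ^ 2 := by
    rw [← enorm_pow]
    refine h5.trans ?_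
    calc _ ≤ 2 * (D * D) := by
          norm_num
          gcongr
          · exact le_self_add
          · exact le_add_self
      _ ≤ 2 * 2 * (D * D) := by
          gcongr
          norm_num
      _ = _ := by ring
  have h7 := (ENNReal.pow_le_pow_left_iff two_ne_zero).1 h6
  exact_mod_cast h7

theorem exists_sobolev_critical {N : ℕ} (hN : 3 ≤ N) : ∃ C : NNReal,
    ∀ φ : EuclideanSpace ℝ (Fin N) → ℝ, ContDiff ℝ 1 φ → HasCompactSupport φ →
      eLpNorm φ (ENNReal.ofReal (2 * (N : ℝ) / ((N : ℝ) - 2))) volume ≤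
        C * eLpNorm (fderiv ℝ φ) 2 volume := by
  have hN' : (3 : ℝ) ≤ N := by exact_mod_cast hN
  refine ⟨eLpNormLESNormFDerivOfEqInnerConst
    (volume : Measure (EuclideanSpace ℝ (Fin N))) 2, fun φ h1 h2 => ?_⟩
  have := eLpNorm_le_eLpNorm_fderiv_of_eq_inner volume h1 h2 (p := 2)
    (p' := (2 * (N : ℝ) / ((N : ℝ) - 2)).toNNReal) one_le_two (by simp; omega) (by
      rw [Real.coe_toNNReal _ (div_nonneg (by positivity) (by linarith))]
      have : (N : ℝ) - 2 ≠ 0 := by linarith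
      simp
      field_simp)
  exact this

theorem exists_sobolev {N : ℕ} (hN : 1 ≤ N) {p : ℝ} (hp : 2 ≤ p)
    (hpN : 3 ≤ N → p ≤ 2 * (N : ℝ) / ((N : ℝ) - 2)) : ∃ C : NNReal,
    ∀ φ : EuclideanSpace ℝ (Fin N) → ℝ, ContDiff ℝ 1 φ → HasCompactSupport φ →
      eLpNorm φ (ENNReal.ofReal p) volume ≤
        C * (eLpNorm φ 2 volume + eLpNorm (fderiv ℝ φ) 2 volume) := by
  rcases (by omega : N = 1 ∨ N = 2 ∨ 3 ≤ N) with rfl | rfl | h3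
  · exact exists_sobolev_dim_one hp
  · exact exists_sobolev_dim_two (by simp) volume hp
  · obtain ⟨C, hC⟩ := exists_sobolev_critical h3
    refine ⟨2 * (C + 1), fun φ h1 h2 => ?_⟩
    set D := eLpNorm φ 2 volume + eLpNorm (fderiv ℝ φ) 2 volume with hD
    have h6 := eLpNorm_le_of_eLpNorm_two_of_eLpNorm (ν := volume) (f := φ)
      h1.continuous.aestronglyMeasurable hp (hpN h3) (D := (C + 1) * D)
      (by rw [add_mul, one_mul]; exact le_self_add.trans le_add_self)
      (by
        rw [add_mul, one_mul]
        refine (hC φ h1 h2).trans (le_trans ?_ le_self_add)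
        gcongr
        exact le_add_self)
    refine h6.trans (le_of_eq ?_)
    push_cast
    rw [mul_assoc]

end Sobolev

/-! ### Passage from test functions to their closure. -/

/-- Closed graph theorem: limits in `L^q` and in `L^r` agree, since both are a.e. limits along a
common subsequence. Thus mere membership in `L^r`, as in the hypothesis that `-Δ + κ_i` is well
defined, already yields a continuous map. -/
theorem exists_continuousLinearMap_of_memLp {X Y : Type*} [MeasurableSpace X]
    [NormedAddCommGroup Y] [NormedSpace ℝ Y] [CompleteSpace Y] {ν : Measure X} {q r : ℝ≥0∞}
    [Fact (1 ≤ q)] [Fact (1 ≤ r)] (f : Y →L[ℝ] Lp ℝ q ν) (h : ∀ w, MemLp (f w) r ν) :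
    ∃ ι : Y →L[ℝ] Lp ℝ r ν, ∀ w, ι w =ᵐ[ν] f w := by
  let T : Y →ₗ[ℝ] Lp ℝ r ν :=
    { toFun := fun w => (h w).toLp _
      map_add' := fun v w => by
        rw [← MemLp.toLp_add]
        refine MemLp.toLp_congr _ _ ?_
        rw [map_add]
        exact Lp.coeFn_add _ _
      map_smul' := fun c v => by
        rw [RingHom.id_apply, ← MemLp.toLp_const_smul]
        refine MemLp.toLp_congr _ _ ?_
        rw [map_smul]
        exact Lp.coeFn_smul _ _ }
  have hT : ∀ w, T w =ᵐ[ν] f w := fun w => (h w).coeFn_toLp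
  refine ⟨⟨T, T.continuous_of_seq_closed_graph fun u x y hu hy => ?_⟩, hT⟩
  have h1 : Tendsto (fun n => f (u n)) atTop (𝓝 (f x)) := (f.continuous.tendsto _).comp hu
  obtain ⟨ns, hns, hae⟩ := (tendstoInMeasure_of_tendsto_Lp h1).exists_seq_tendsto_ae
  obtain ⟨ms, hms, hae'⟩ := (tendstoInMeasure_of_tendsto_Lp
    (hy.comp hns.tendsto_atTop)).exists_seq_tendsto_ae
  refine Lp.ext ?_
  have hall : ∀ᵐ z ∂ν, ∀ n, (T (u n)) z = f (u n) z := ae_all_iff.2 fun n => hT (u n)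
  filter_upwards [hae, hae', hall, hT x] with z h2 h3 h4 h5
  rw [h5]
  refine tendsto_nhds_unique h3 ((h2.comp hms.tendsto_atTop).congr fun n => ?_)
  exact (h4 _).symm

section SobolevZero

variable {N : ℕ} {Ω : Set (EuclideanSpace ℝ (Fin N))} {q : ℝ≥0∞} [Fact (1 ≤ q)]

instance completeSpace_sobolevZero : CompleteSpace ↥(sobolevZero Ω q) :=
  inferInstanceAs (CompleteSpace ↥(testPairs Ω q).topologicalClosure)

theorem mem_sobolevZero_iff {w : Lp ℝ q (volume.restrict Ω) ×
      Lp (EuclideanSpace ℝ (Fin N)) 2 (volume.restrict Ω)} :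
    w ∈ sobolevZero Ω q ↔ w ∈ closure (testPairs Ω q : Set (Lp ℝ q (volume.restrict Ω) ×
      Lp (EuclideanSpace ℝ (Fin N)) 2 (volume.restrict Ω))) := Iff.rfl

theorem enorm_gradient (φ : EuclideanSpace ℝ (Fin N) → ℝ) (x : EuclideanSpace ℝ (Fin N)) :
    ‖gradient φ x‖ₑ = ‖fderiv ℝ φ x‖ₑ := by
  rw [gradient, LinearIsometryEquiv.enorm_map]

theorem eLpNorm_gradient (φ : EuclideanSpace ℝ (Fin N) → ℝ) (r : ℝ≥0∞)
    (ν : Measure (EuclideanSpace ℝ (Fin N))) :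
    eLpNorm (gradient φ) r ν = eLpNorm (fderiv ℝ φ) r ν :=
  eLpNorm_congr_enorm_ae (Eventually.of_forall (enorm_gradient φ))

theorem eLpNorm_restrict_of_tsupport_subset {φ : EuclideanSpace ℝ (Fin N) → ℝ}
    (h : tsupport φ ⊆ Ω) (r : ℝ≥0∞) :
    eLpNorm φ r (volume.restrict Ω) = eLpNorm φ r volume :=
  eLpNorm_restrict_eq_of_support_subset ((subset_tsupport φ).trans h)

theorem eLpNorm_gradient_restrict_of_tsupport_subset {φ : EuclideanSpace ℝ (Fin N) → ℝ}
    (h : tsupport φ ⊆ Ω) (r : ℝ≥0∞) :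
    eLpNorm (gradient φ) r (volume.restrict Ω) = eLpNorm (gradient φ) r volume := by
  refine eLpNorm_restrict_eq_of_support_subset fun x hx => h (support_fderiv_subset ℝ ?_)
  rw [Function.mem_support] at hx ⊢
  contrapose! hx
  rw [gradient, hx, map_zero]

/-- The approximating test functions are bounded in `L^r`, and Fatou's lemma passes the bound to an
a.e. limit of a subsequence. -/
theorem memLp_of_mem_sobolevZero {r : ℝ≥0∞} {C : NNReal}
    (hC : ∀ φ : EuclideanSpace ℝ (Fin N) → ℝ, ContDiff ℝ ∞ φ → HasCompactSupport φ →
      tsupport φ ⊆ Ω → eLpNorm φ r (volume.restrict Ω) ≤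
        C * (eLpNorm φ q (volume.restrict Ω) + eLpNorm (gradient φ) 2 (volume.restrict Ω)))
    {w : Lp ℝ q (volume.restrict Ω) × Lp (EuclideanSpace ℝ (Fin N)) 2 (volume.restrict Ω)}
    (hw : w ∈ sobolevZero Ω q) : MemLp w.1 r (volume.restrict Ω) := by
  obtain ⟨s, hs, hsw⟩ := mem_closure_iff_seq_limit.1 (mem_sobolevZero_iff.1 hw)
  have hb : ∀ᶠ n in atTop, eLpNorm (s n).1 r (volume.restrict Ω) ≤
      C * (2 * ENNReal.ofReal (‖w‖ + 1)) := by
    have h1 : ∀ᶠ n in atTop, ‖s n‖ < ‖w‖ + 1 :=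
      (hsw.norm).eventually_lt_const (by linarith)
    filter_upwards [h1] with n hn
    obtain ⟨φ, k1, k2, k3, k4, k5⟩ := hs n
    rw [eLpNorm_congr_ae k4]
    refine (hC φ k1 k2 k3).trans ?_
    rw [← eLpNorm_congr_ae k4, ← eLpNorm_congr_ae k5, two_mul, ← Lp.enorm_def, ← Lp.enorm_def]
    gcongr
    · rw [← ofReal_norm]
      exact ENNReal.ofReal_le_ofReal ((norm_fst_le _).trans hn.le)
    · rw [← ofReal_norm]
      exact ENNReal.ofReal_le_ofReal ((norm_snd_le _).trans hn.le)
  have h1 : Tendsto (fun n => (s n).1) atTop (𝓝 w.1) := (continuous_fst.tendsto _).comp hsw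
  obtain ⟨ns, hns, hae⟩ := (tendstoInMeasure_of_tendsto_Lp h1).exists_seq_tendsto_ae
  have h2 := Lp.eLpNorm_le_of_ae_tendsto (hns.tendsto_atTop.eventually hb)
    (fun n => Lp.aestronglyMeasurable (s (ns n)).1) hae
  refine ⟨Lp.aestronglyMeasurable w.1, lt_of_le_of_lt h2 ?_⟩
  exact ENNReal.mul_lt_top ENNReal.coe_lt_top
    (ENNReal.mul_lt_top ENNReal.ofNat_lt_top ENNReal.ofReal_lt_top)

theorem norm_fst_le_of_mem_sobolevZero {C : NNReal}
    (hC : ∀ φ : EuclideanSpace ℝ (Fin N) → ℝ, ContDiff ℝ ∞ φ → HasCompactSupport φ →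
      tsupport φ ⊆ Ω → eLpNorm φ q (volume.restrict Ω) ≤
        C * eLpNorm (gradient φ) 2 (volume.restrict Ω))
    {w : Lp ℝ q (volume.restrict Ω) × Lp (EuclideanSpace ℝ (Fin N)) 2 (volume.restrict Ω)}
    (hw : w ∈ sobolevZero Ω q) : ‖w.1‖ ≤ C * ‖w.2‖ := by
  have hcl : IsClosed {w : Lp ℝ q (volume.restrict Ω) ×
      Lp (EuclideanSpace ℝ (Fin N)) 2 (volume.restrict Ω) | ‖w.1‖ ≤ C * ‖w.2‖} :=
    isClosed_le continuous_fst.norm (continuous_const.mul continuous_snd.norm)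
  refine closure_minimal (s := (testPairs Ω q : Set _)) ?_ hcl (mem_sobolevZero_iff.1 hw)
  rintro v ⟨φ, k1, k2, k3, k4, k5⟩
  have h1 := hC φ k1 k2 k3
  rw [← eLpNorm_congr_ae k4, ← eLpNorm_congr_ae k5] at h1
  rw [mem_ofPred_eq, Lp.norm_def, Lp.norm_def, ← ENNReal.coe_toReal C, ← ENNReal.toReal_mul]
  exact ENNReal.toReal_mono (ENNReal.mul_ne_top ENNReal.coe_ne_top (Lp.eLpNorm_ne_top _)) h1

end SobolevZero

theorem MeasureTheory.Lp.integral_norm_sq {X F : Type*} [MeasurableSpace X]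
    [NormedAddCommGroup F] [InnerProductSpace ℝ F] {ν : Measure X} {r : ℝ≥0∞} (hr : r = 2)
    (f : Lp F r ν) : ∫ x, ‖f x‖ ^ 2 ∂ν = ‖f‖ ^ 2 := by
  subst hr
  rw [← real_inner_self_eq_norm_sq, L2.inner_def]
  simp_rw [real_inner_self_eq_norm_sq]

theorem MeasureTheory.Lp.integrable_norm_sq {X F : Type*} [MeasurableSpace X]
    [NormedAddCommGroup F] {ν : Measure X} {r : ℝ≥0∞} (hr : r = 2)
    (f : Lp F r ν) : Integrable (fun x => ‖f x‖ ^ 2) ν := by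
  subst hr
  exact (Lp.memLp f).integrable_norm_pow two_ne_zero

/-! ### The space `H`, its embedding into `L^p`, and the forms `⟨·,·⟩_i`. -/

namespace CompetitiveSystem

variable {N M : ℕ} (S : CompetitiveSystem N M)

theorem one_lt_p : 1 < S.p := by linarith [S.two_lt_p]

instance fact_one_le_p : Fact (1 ≤ ENNReal.ofReal S.p) :=
  ⟨ENNReal.one_le_ofReal.2 S.one_lt_p.le⟩

/-- The inclusion of `H` into `L^q(Ω)`. -/
def fnL : S.H →L[ℝ] Lp ℝ S.q (volume.restrict S.Ω) :=
  (ContinuousLinearMap.fst ℝ _ _).comp (Submodule.subtypeL (sobolevZero S.Ω S.q))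

/-- The weak gradient as a continuous linear map. -/
def gradL : S.H →L[ℝ] Lp (EuclideanSpace ℝ (Fin N)) 2 (volume.restrict S.Ω) :=
  (ContinuousLinearMap.snd ℝ _ _).comp (Submodule.subtypeL (sobolevZero S.Ω S.q))

theorem memLp_fn (hN : 1 ≤ N) (v : S.H) :
    MemLp (S.fn v) (ENNReal.ofReal S.p) (volume.restrict S.Ω) := by
  cases hk : S.kind with
  | H10 =>
    have hq : S.q = 2 := by unfold q; rw [hk]
    obtain ⟨C, hC⟩ := exists_sobolev hN S.two_lt_p.le S.p_le
    refine memLp_of_mem_sobolevZero (C := C) (fun φ h1 h2 h3 => ?_) v.2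
    rw [eLpNorm_restrict_of_tsupport_subset h3, eLpNorm_restrict_of_tsupport_subset h3,
      eLpNorm_gradient_restrict_of_tsupport_subset h3, eLpNorm_gradient, hq]
    exact hC φ (h1.of_le (by simp)) h2
  | D120 =>
    have hq : S.q = ENNReal.ofReal S.p := by unfold q; rw [hk]
    rw [← hq]
    exact Lp.memLp _

theorem exists_fn_embedding (hN : 1 ≤ N) :
    ∃ ι : S.H →L[ℝ] Lp ℝ (ENNReal.ofReal S.p) (volume.restrict S.Ω),
      ∀ v, ι v =ᵐ[volume.restrict S.Ω] S.fn v :=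
  exists_continuousLinearMap_of_memLp S.fnL (S.memLp_fn hN)

/-- Makes coercivity usable for the norm that `H` inherits from `L^q × L²`. For `D120` the function
part of that norm is absorbed by the gradient through the Sobolev or assumed embedding inequality.
-/
theorem exists_stdNormSq_ge (hemb : S.SobolevEmbedding) :
    ∃ c : ℝ, 0 < c ∧ ∀ v : S.H, c * ‖v‖ ^ 2 ≤ S.stdNormSq v := by
  cases hk : S.kind with
  | H10 =>
    have hq : S.q = 2 := by unfold q; rw [hk]
    refine ⟨1, one_pos, fun v => ?_⟩
    have e : S.stdNormSq v = ‖v.1.2‖ ^ 2 + ‖v.1.1‖ ^ 2 := by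
      unfold stdNormSq
      rw [hk]
      simp only
      rw [← Lp.integral_norm_sq rfl v.1.2, ← Lp.integral_norm_sq hq v.1.1,
        ← integral_add (Lp.integrable_norm_sq rfl _) (Lp.integrable_norm_sq hq _)]
      simp [grad, fn]
    rw [e, one_mul, Submodule.coe_norm, Prod.norm_def]
    rcases max_choice ‖v.1.1‖ ‖v.1.2‖ with h | h <;> rw [h] <;>
      nlinarith [sq_nonneg ‖v.1.1‖, sq_nonneg ‖v.1.2‖]
  | D120 =>
    have hq : S.q = ENNReal.ofReal S.p := by unfold q; rw [hk]
    have hC : ∃ C : NNReal, ∀ φ : EuclideanSpace ℝ (Fin N) → ℝ, ContDiff ℝ ∞ φ →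
        HasCompactSupport φ → tsupport φ ⊆ S.Ω → eLpNorm φ S.q (volume.restrict S.Ω) ≤
        C * eLpNorm (gradient φ) 2 (volume.restrict S.Ω) := by
      unfold SobolevEmbedding at hemb
      rw [hk] at hemb
      rcases hemb with ⟨h3, hp⟩ | ⟨C, hC⟩
      · obtain ⟨C, hC⟩ := exists_sobolev_critical h3
        refine ⟨C, fun φ h1 h2 h3 => ?_⟩
        rw [eLpNorm_restrict_of_tsupport_subset h3,
          eLpNorm_gradient_restrict_of_tsupport_subset h3, hq, hp, eLpNorm_gradient]
        exact hC φ (h1.of_le (by simp)) h2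
      · refine ⟨C.toNNReal, fun φ h1 h2 h3 => ?_⟩
        rw [eLpNorm_restrict_of_tsupport_subset h3,
          eLpNorm_gradient_restrict_of_tsupport_subset h3, hq]
        exact hC φ h1 h2 h3
    obtain ⟨C, hC⟩ := hC
    refine ⟨1 / (C + 1) ^ 2, by positivity, fun v => ?_⟩
    have e : S.stdNormSq v = ‖v.1.2‖ ^ 2 := by
      unfold stdNormSq
      rw [hk]
      exact Lp.integral_norm_sq rfl v.1.2
    have h1 := norm_fst_le_of_mem_sobolevZero hC v.2
    have h2 : ‖v‖ ≤ (C + 1) * ‖v.1.2‖ := by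
      rw [Submodule.coe_norm, Prod.norm_def, max_le_iff]
      have := norm_nonneg v.1.2
      have h3 : (0 : ℝ) ≤ C * ‖v.1.2‖ := by positivity
      constructor <;> linarith
    rw [e, one_div_mul_eq_div, div_le_iff₀ (by positivity), mul_comm, ← mul_pow]
    gcongr

/-- Bilinearity and smoothness of the integral form are read off from this continuous bilinear map.
When `κ_i ≠ 0` the zeroth-order term uses the continuous inclusion of `H` into `L²`. -/
theorem exists_innerI_eq (hcoer : S.Coercive) (i : Fin M) :
    ∃ B : S.H →L[ℝ] S.H →L[ℝ] ℝ, ∀ v w, B v w = S.innerI i v w := by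
  have hγ : ∀ v w : S.H, inner ℝ (S.gradL v) (S.gradL w) =
      ∫ x in S.Ω, inner ℝ (S.grad v x) (S.grad w x) := fun v w =>
    L2.inner_def (S.gradL v) (S.gradL w)
  have hγi : ∀ v w : S.H, Integrable (fun x => (inner ℝ (S.grad v x) (S.grad w x) : ℝ))
      (volume.restrict S.Ω) := fun v w => L2.integrable_inner (𝕜 := ℝ) (S.gradL v) (S.gradL w)
  by_cases hκ : S.κ i = 0
  · refine ⟨(innerSL ℝ).bilinearComp S.gradL S.gradL, fun v w => ?_⟩
    unfold innerI
    simp only [hκ, zero_mul, add_zero]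
    exact hγ v w
  · obtain ⟨ι, hι⟩ := exists_continuousLinearMap_of_memLp S.fnL ((hcoer i).1 hκ)
    have hιe : ∀ v w : S.H, (fun x => inner ℝ (ι v x) (ι w x)) =ᵐ[volume.restrict S.Ω]
        fun x => S.fn v x * S.fn w x := fun v w => by
      filter_upwards [hι v, hι w] with x h1 h2
      rw [h1, h2, RCLike.inner_apply, conj_trivial, mul_comm]
      rfl
    refine ⟨(innerSL ℝ).bilinearComp S.gradL S.gradL +
      S.κ i • (innerSL ℝ).bilinearComp ι ι, fun v w => ?_⟩
    have h2 : inner ℝ (ι v) (ι w) = ∫ x in S.Ω, S.fn v x * S.fn w x := by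
      rw [L2.inner_def]
      exact integral_congr_ae (hιe v w)
    have h3 : Integrable (fun x => S.fn v x * S.fn w x) (volume.restrict S.Ω) :=
      (L2.integrable_inner (𝕜 := ℝ) (ι v) (ι w)).congr (hιe v w)
    have h4 := integral_add (hγi v w) (h3.const_mul (S.κ i))
    rw [integral_const_mul, ← h2, ← hγ] at h4
    exact h4.symm

theorem innerI_comm (i : Fin M) (v w : S.H) : S.innerI i v w = S.innerI i w v := by
  unfold innerI
  congr 1
  funext x
  rw [real_inner_comm, mul_comm (S.fn v x)]

theorem exists_innerI_ge (hemb : S.SobolevEmbedding) (hcoer : S.Coercive) (i : Fin M) :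
    ∃ c : ℝ, 0 < c ∧ ∀ v : S.H, c * ‖v‖ ^ 2 ≤ S.innerI i v v := by
  obtain ⟨c, hc, h⟩ := S.exists_stdNormSq_ge hemb
  obtain ⟨d, hd, h'⟩ := (hcoer i).2
  refine ⟨d * c, mul_pos hd hc, fun v => le_trans ?_ (h' v)⟩
  rw [mul_assoc]
  gcongr
  exact h v

end CompetitiveSystem

theorem contDiff_abs_rpow {r : ℝ} (hr : 1 < r) : ContDiff ℝ 1 (fun x : ℝ => |x| ^ r) :=
  contDiff_norm_rpow hr

/-! ### The parts of the energy: smoothness, scaling, and the Nehari equations. -/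

namespace CompetitiveSystem

variable {N M : ℕ} (S : CompetitiveSystem N M)

/-- The quadratic part `‖u_i‖_i²`. -/
def quadPart (i : Fin M) (u : S.HM) : ℝ := S.innerI i (u i) (u i)

/-- The self-interaction `∫ μ_i |u_i|^p`. -/
def selfPart (i : Fin M) (u : S.HM) : ℝ := ∫ x in S.Ω, S.μ i * |S.fn (u i) x| ^ S.p

/-- The repulsive interaction `-∫ λ_{ij} |u_j|^{α_{ij}} |u_i|^{β_{ij}}`. -/
def crossPart (i j : Fin M) (u : S.HM) : ℝ :=
  -∫ x in S.Ω, S.lam i j * |S.fn (u j) x| ^ S.α i j * |S.fn (u i) x| ^ S.β i j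

/-- The expression of `∂_i 𝒥(u) u_i`. -/
def nehariPart (i : Fin M) (u : S.HM) : ℝ :=
  S.quadPart i u - S.selfPart i u +
    ∑ j ∈ Finset.univ.filter (fun j => j ≠ i), S.β i j * S.crossPart i j u

variable {S}

theorem innerI_self_nonneg (hemb : S.SobolevEmbedding) (hcoer : S.Coercive) (i : Fin M) (v : S.H) :
    0 ≤ S.innerI i v v := by
  obtain ⟨c, hc, h⟩ := S.exists_innerI_ge hemb hcoer i
  exact le_trans (by positivity) (h v)

theorem innerI_self_pos (hemb : S.SobolevEmbedding) (hcoer : S.Coercive) (i : Fin M) {v : S.H}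
    (hv : v ≠ 0) : 0 < S.innerI i v v := by
  obtain ⟨c, hc, h⟩ := S.exists_innerI_ge hemb hcoer i
  have := norm_pos_iff.2 hv
  exact lt_of_lt_of_le (by positivity) (h v)

theorem normI_sq (hemb : S.SobolevEmbedding) (hcoer : S.Coercive) (i : Fin M) (v : S.H) :
    S.normI i v ^ 2 = S.innerI i v v :=
  Real.sq_sqrt (innerI_self_nonneg hemb hcoer i v)

theorem J_eq (hemb : S.SobolevEmbedding) (hcoer : S.Coercive) (u : S.HM) :
    S.J u = 1 / 2 * (∑ i, S.quadPart i u) - 1 / S.p * (∑ i, S.selfPart i u) +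
      1 / 2 * (∑ i, ∑ j ∈ Finset.univ.filter (fun j => j ≠ i), S.crossPart i j u) := by
  unfold J quadPart selfPart crossPart
  simp only [normI_sq hemb hcoer, Finset.sum_neg_distrib]
  ring

theorem crossPart_nonneg {i j : Fin M} (h : i ≠ j) (u : S.HM) : 0 ≤ S.crossPart i j u :=
  neg_nonneg.2 (integral_nonpos fun _ => mul_nonpos_of_nonpos_of_nonneg
    (mul_nonpos_of_nonpos_of_nonneg (S.lam_neg i j h).le (Real.rpow_nonneg (abs_nonneg _) _))
    (Real.rpow_nonneg (abs_nonneg _) _))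

theorem crossPart_comm {i j : Fin M} (h : i ≠ j) (u : S.HM) :
    S.crossPart i j u = S.crossPart j i u := by
  unfold crossPart
  congr 2
  funext x
  rw [S.lam_symm i j h, S.α_eq_β i j h, S.α_eq_β j i h.symm]
  ring

theorem innerI_smul_smul (hcoer : S.Coercive) (i : Fin M) (c d : ℝ) (v w : S.H) :
    S.innerI i (c • v) (d • w) = c * d * S.innerI i v w := by
  obtain ⟨B, hB⟩ := S.exists_innerI_eq hcoer i
  simp only [← hB, map_smul, smul_apply, smul_eq_mul]
  ring

theorem fn_smul (c : ℝ) (v : S.H) :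
    ∀ᵐ x ∂(volume.restrict S.Ω), S.fn (c • v) x = c * S.fn v x := by
  filter_upwards [Lp.coeFn_smul c v.1.1] with x hx
  exact hx

theorem quadPart_scale (hcoer : S.Coercive) (i : Fin M) (s : Fin M → ℝ) (u : S.HM) :
    S.quadPart i (S.scale s u) = s i ^ 2 * S.quadPart i u := by
  unfold quadPart scale
  rw [innerI_smul_smul hcoer, sq]

theorem selfPart_scale (i : Fin M) (s : Fin M → ℝ) (u : S.HM) :
    S.selfPart i (S.scale s u) = |s i| ^ S.p * S.selfPart i u := by
  unfold selfPart scale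
  rw [← integral_const_mul]
  refine integral_congr_ae ?_
  filter_upwards [fn_smul (s i) (u i)] with x hx
  rw [hx, abs_mul, Real.mul_rpow (abs_nonneg _) (abs_nonneg _)]
  ring

theorem crossPart_scale (i j : Fin M) (s : Fin M → ℝ) (u : S.HM) :
    S.crossPart i j (S.scale s u) = |s j| ^ S.α i j * |s i| ^ S.β i j * S.crossPart i j u := by
  unfold crossPart scale
  rw [mul_neg, ← integral_const_mul]
  congr 1
  refine integral_congr_ae ?_
  filter_upwards [fn_smul (s i) (u i), fn_smul (s j) (u j)] with x hx hx'
  rw [hx, hx', abs_mul, abs_mul, Real.mul_rpow (abs_nonneg _) (abs_nonneg _),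
    Real.mul_rpow (abs_nonneg _) (abs_nonneg _)]
  ring

theorem contDiff_quadPart (hcoer : S.Coercive) (i : Fin M) : ContDiff ℝ 1 (S.quadPart i) := by
  obtain ⟨B, hB⟩ := S.exists_innerI_eq hcoer i
  have : S.quadPart i = fun u => B (u i) (u i) := funext fun u => (hB _ _).symm
  rw [this]
  have h1 : ContDiff ℝ 1 fun u : S.HM => u i := contDiff_apply ℝ S.H i
  exact (B.contDiff.comp h1).clm_apply h1

variable (S) in
-- Gathers the components into one vector-valued `L^p` function, so that self- and
-- cross-interactions fall under the same result on homogeneous integrands.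
theorem exists_toLp (hN : 1 ≤ N) :
    ∃ L : S.HM →L[ℝ] Lp (Fin M → ℝ) (ENNReal.ofReal S.p) (volume.restrict S.Ω),
      ∀ u, ∀ᵐ x ∂(volume.restrict S.Ω), L u x = fun k => S.fn (u k) x := by
  obtain ⟨ι, hι⟩ := S.exists_fn_embedding hN
  let c : Fin M → (ℝ →L[ℝ] (Fin M → ℝ)) := fun k => ContinuousLinearMap.single ℝ (fun _ => ℝ) k
  let L : S.HM →L[ℝ] Lp (Fin M → ℝ) (ENNReal.ofReal S.p) (volume.restrict S.Ω) :=
    ∑ k, ((c k).compLpL (ENNReal.ofReal S.p) (volume.restrict S.Ω)).comp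
      (ι.comp (ContinuousLinearMap.proj k))
  refine ⟨L, fun u => ?_⟩
  have hL : L u = ∑ k, (c k).compLp (ι (u k)) := by
    simp only [L, sum_apply]
    rfl
  have h1 : ∀ᵐ x ∂(volume.restrict S.Ω), ∀ k, (c k).compLp (ι (u k)) x = c k (ι (u k) x) :=
    ae_all_iff.2 fun k => (c k).coeFn_compLp (ι (u k))
  have h2 : ∀ᵐ x ∂(volume.restrict S.Ω), ∀ k, ι (u k) x = S.fn (u k) x :=
    ae_all_iff.2 fun k => hι (u k)
  rw [hL]
  filter_upwards [h1, h2, Lp.coeFn_finsetSum Finset.univ (fun k => (c k).compLp (ι (u k)))]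
    with x h3 h4 h5
  rw [h5, Finset.sum_apply]
  funext k
  rw [Finset.sum_apply, Finset.sum_congr rfl fun j _ => by rw [h3 j, h4 j]]
  simp [c, Pi.single_apply]

theorem contDiff_integral_fn (hN : 1 ≤ N) {W : (Fin M → ℝ) → ℝ} (hW : ContDiff ℝ 1 W)
    (hom : ∀ t : ℝ, 0 < t → ∀ y, W (t • y) = t ^ S.p * W y) :
    ContDiff ℝ 1 (fun u : S.HM => ∫ x in S.Ω, W (fun k => S.fn (u k) x)) := by
  obtain ⟨L, hL⟩ := S.exists_toLp hN
  have h := (contDiff_integral_of_homogeneous (ν := volume.restrict S.Ω) S.one_lt_p hW hom).comp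
    L.contDiff
  convert h using 1
  funext u
  refine integral_congr_ae ?_
  filter_upwards [hL u] with x hx
  rw [hx]

theorem contDiff_selfPart (hN : 1 ≤ N) (i : Fin M) : ContDiff ℝ 1 (S.selfPart i) := by
  refine contDiff_integral_fn (W := fun y => S.μ i * |y i| ^ S.p) hN ?_ fun t ht y => ?_
  · exact contDiff_const.mul ((contDiff_abs_rpow S.one_lt_p).comp (contDiff_apply ℝ ℝ i))
  · rw [Pi.smul_apply, smul_eq_mul, abs_mul, abs_of_pos ht, Real.mul_rpow ht.le (abs_nonneg _)]
    ring

/-- The integrand is C¹ because both exponents exceed 1, and has degree `α_ij + β_ij = p`. -/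
theorem contDiff_crossPart (hN : 1 ≤ N) {i j : Fin M} (h : i ≠ j) :
    ContDiff ℝ 1 (S.crossPart i j) := by
  refine (contDiff_integral_fn
    (W := fun y => S.lam i j * |y j| ^ S.α i j * |y i| ^ S.β i j) hN ?_ fun t ht y => ?_).neg
  · exact (contDiff_const.mul ((contDiff_abs_rpow (S.one_lt_α i j h)).comp
      (contDiff_apply ℝ ℝ j))).mul
      ((contDiff_abs_rpow (S.one_lt_β i j h)).comp (contDiff_apply ℝ ℝ i))
  · rw [Pi.smul_apply, Pi.smul_apply, smul_eq_mul, smul_eq_mul, abs_mul, abs_mul, abs_of_pos ht,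
      Real.mul_rpow ht.le (abs_nonneg _), Real.mul_rpow ht.le (abs_nonneg _),
      ← S.α_add_β i j h, Real.rpow_add ht]
    ring

theorem contDiff_J (hN : 1 ≤ N) (hemb : S.SobolevEmbedding) (hcoer : S.Coercive) :
    ContDiff ℝ 1 S.J := by
  rw [funext (J_eq hemb hcoer)]
  refine ((contDiff_const.mul (ContDiff.sum fun i _ => contDiff_quadPart hcoer i)).sub
    (contDiff_const.mul (ContDiff.sum fun i _ => contDiff_selfPart hN i))).add
    (contDiff_const.mul (ContDiff.sum fun i _ => ContDiff.sum fun j hj => ?_))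
  exact contDiff_crossPart hN (Finset.mem_filter.1 hj).2.symm

theorem exists_selfPart_le (hN : 1 ≤ N) (hemb : S.SobolevEmbedding) (hcoer : S.Coercive) :
    ∃ C : ℝ, 0 < C ∧ ∀ (i : Fin M) (u : S.HM),
      S.selfPart i u ≤ C * S.quadPart i u ^ (S.p / 2) := by
  obtain ⟨ι, hι⟩ := S.exists_fn_embedding hN
  have hp : 0 < S.p := by linarith [S.two_lt_p]
  have key : ∀ i : Fin M, ∃ C : ℝ, 0 ≤ C ∧ ∀ u : S.HM,
      S.selfPart i u ≤ C * S.quadPart i u ^ (S.p / 2) := by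
    intro i
    obtain ⟨c, hc, h⟩ := S.exists_innerI_ge hemb hcoer i
    have hμ := S.μ_pos i
    refine ⟨S.μ i * ‖ι‖ ^ S.p * (1 / c) ^ (S.p / 2), by positivity, fun u => ?_⟩
    have e : S.selfPart i u = S.μ i * ‖ι (u i)‖ ^ S.p := by
      unfold selfPart
      rw [integral_const_mul, ← Lp.integral_norm_rpow S.one_lt_p]
      congr 1
      refine integral_congr_ae ?_
      filter_upwards [hι (u i)] with x hx
      rw [hx, Real.norm_eq_abs]
    have hq : 0 ≤ S.quadPart i u := innerI_self_nonneg hemb hcoer i _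
    have h2 : ‖u i‖ ^ S.p ≤ (1 / c) ^ (S.p / 2) * S.quadPart i u ^ (S.p / 2) := by
      rw [← Real.mul_rpow (by positivity) hq]
      have : ‖u i‖ ^ S.p = (‖u i‖ ^ 2) ^ (S.p / 2) := by
        rw [← Real.rpow_natCast, ← Real.rpow_mul (norm_nonneg _)]
        congr 1
        push_cast
        ring
      rw [this]
      refine Real.rpow_le_rpow (by positivity) ?_ (by positivity)
      rw [one_div, ← div_eq_inv_mul, le_div_iff₀ hc, mul_comm]
      exact h (u i)
    rw [e]
    calc S.μ i * ‖ι (u i)‖ ^ S.p ≤ S.μ i * (‖ι‖ * ‖u i‖) ^ S.p := by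
          gcongr
          exact ι.le_opNorm _
      _ = S.μ i * ‖ι‖ ^ S.p * ‖u i‖ ^ S.p := by
          rw [Real.mul_rpow (norm_nonneg ι) (norm_nonneg (u i))]
          ring
      _ ≤ S.μ i * ‖ι‖ ^ S.p * ((1 / c) ^ (S.p / 2) * S.quadPart i u ^ (S.p / 2)) := by gcongr
      _ = _ := by ring
  choose C hC0 hC using key
  have hs : 0 ≤ ∑ i, C i := Finset.sum_nonneg fun i _ => hC0 i
  refine ⟨∑ i, C i + 1, by linarith, fun i u => (hC i u).trans ?_⟩
  have hq : 0 ≤ S.quadPart i u := innerI_self_nonneg hemb hcoer i _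
  have : C i ≤ ∑ i, C i := Finset.single_le_sum (f := C) (fun i _ => hC0 i) (Finset.mem_univ i)
  gcongr
  linarith

theorem scale_update_eq (u : S.HM) (i : Fin M) (t : ℝ) :
    S.scale (Function.update 1 i t) u = u + (t - 1) • (Pi.single i (u i) : S.HM) := by
  funext k
  unfold scale
  rcases eq_or_ne k i with rfl | h
  · have h : t • u k = u k + (t - 1) • u k := by module
    simpa using h
  · simp [h]

/-- Differentiate `J` at `t = 1` while multiplying only `u_i` by `t`, once by the chain rule and
once from the scaling laws of the parts. -/
theorem fderiv_J_single (hN : 1 ≤ N) (hemb : S.SobolevEmbedding) (hcoer : S.Coercive)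
    (i : Fin M) (u : S.HM) : fderiv ℝ S.J u (Pi.single i (u i)) = S.nehariPart i u := by
  have hJ : HasDerivAt (fun t : ℝ => S.J (S.scale (Function.update 1 i t) u))
      (fderiv ℝ S.J u (Pi.single i (u i))) 1 := by
    have h1 : HasDerivAt (fun t : ℝ => S.scale (Function.update 1 i t) u)
        (Pi.single i (u i)) 1 := by
      rw [funext (scale_update_eq u i)]
      simpa using (((hasDerivAt_id (1 : ℝ)).sub_const 1).smul_const
        (Pi.single i (u i) : S.HM)).const_add u
    have h2 : HasFDerivAt S.J (fderiv ℝ S.J u)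
        ((fun t : ℝ => S.scale (Function.update 1 i t) u) 1) := by
      have : (fun t : ℝ => S.scale (Function.update 1 i t) u) 1 = u := by
        beta_reduce
        rw [scale_update_eq, sub_self, zero_smul, add_zero]
      rw [this]
      exact ((contDiff_J hN hemb hcoer).differentiable one_ne_zero u).hasFDerivAt
    exact h2.comp_hasDerivAt 1 h1
  have hs : ∀ k, HasDerivAt (fun t : ℝ => |Function.update (1 : Fin M → ℝ) i t k|)
      (if k = i then 1 else 0) 1 := by
    intro k
    rcases eq_or_ne k i with rfl | h
    · simpa using hasDerivAt_abs_pos (one_pos)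
    · simpa [h] using hasDerivAt_const (1 : ℝ) (1 : ℝ)
  have hs1 : ∀ k, |Function.update (1 : Fin M → ℝ) i 1 k| = 1 := by
    intro k
    rcases eq_or_ne k i with rfl | h
    · simp
    · simp [h]
  have hr : ∀ k (r : ℝ), HasDerivAt (fun t : ℝ => |Function.update (1 : Fin M → ℝ) i t k| ^ r)
      (if k = i then r else 0) 1 := by
    intro k r
    have := (hs k).rpow_const (p := r) (Or.inl (by rw [hs1]; exact one_ne_zero))
    rw [hs1, Real.one_rpow] at this
    refine this.congr_deriv ?_
    split_ifs <;> ring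
  have hE : HasDerivAt (fun t : ℝ => S.J (S.scale (Function.update 1 i t) u))
      (1 / 2 * (∑ k, (if k = i then 2 else 0) * S.quadPart k u) -
        1 / S.p * (∑ k, (if k = i then S.p else 0) * S.selfPart k u) +
        1 / 2 * (∑ k, ∑ j ∈ Finset.univ.filter (fun j => j ≠ k),
          ((if j = i then S.α k j else 0) + (if k = i then S.β k j else 0)) *
            S.crossPart k j u)) 1 := by
    have e : (fun t : ℝ => S.J (S.scale (Function.update 1 i t) u)) = fun t =>
        1 / 2 * (∑ k, |Function.update (1 : Fin M → ℝ) i t k| ^ (2 : ℝ) * S.quadPart k u) -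
        1 / S.p * (∑ k, |Function.update (1 : Fin M → ℝ) i t k| ^ S.p * S.selfPart k u) +
        1 / 2 * (∑ k, ∑ j ∈ Finset.univ.filter (fun j => j ≠ k),
          |Function.update (1 : Fin M → ℝ) i t j| ^ S.α k j *
            |Function.update (1 : Fin M → ℝ) i t k| ^ S.β k j * S.crossPart k j u) := by
      funext t
      rw [J_eq hemb hcoer]
      simp only [quadPart_scale hcoer, selfPart_scale, crossPart_scale, Real.rpow_two, sq_abs]
    rw [e]
    refine ((HasDerivAt.const_mul _ (HasDerivAt.fun_sum fun k _ => (hr k 2).mul_const _)).sub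
      (HasDerivAt.const_mul _ (HasDerivAt.fun_sum fun k _ => (hr k S.p).mul_const _))).add
      (HasDerivAt.const_mul _ (HasDerivAt.fun_sum fun k _ => HasDerivAt.fun_sum fun j _ => ?_))
    have := ((hr j (S.α k j)).mul (hr k (S.β k j))).mul_const (S.crossPart k j u)
    rw [hs1, hs1, Real.one_rpow, Real.one_rpow, mul_one, one_mul] at this
    exact this
  rw [hJ.unique hE]
  have hp : S.p ≠ 0 := by linarith [S.two_lt_p]
  have h1 : (∑ k, (if k = i then (2 : ℝ) else 0) * S.quadPart k u) = 2 * S.quadPart i u := by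
    simp [ite_mul]
  have h2 : (∑ k, (if k = i then S.p else 0) * S.selfPart k u) = S.p * S.selfPart i u := by
    simp [ite_mul]
  -- The index `i` occurs once as the first and once as the second index. By `α_ki = β_ik` and the
  -- symmetry of the interaction the two contributions agree, and the factor 2 cancels the 1/2 in
  -- `J`.
  have h3 : (∑ k, ∑ j ∈ Finset.univ.filter (fun j => j ≠ k),
      ((if j = i then S.α k j else 0) + (if k = i then S.β k j else 0)) * S.crossPart k j u) =
      2 * ∑ j ∈ Finset.univ.filter (fun j => j ≠ i), S.β i j * S.crossPart i j u := by
    simp only [add_mul, Finset.sum_add_distrib, Finset.sum_filter, two_mul]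
    congr 1
    · refine Finset.sum_congr rfl fun k _ => ?_
      rw [Finset.sum_eq_single i (fun j _ hj => by simp [hj]) (by simp)]
      by_cases hk : k = i
      · simp [hk]
      · rw [if_pos (Ne.symm hk), if_pos rfl, if_pos hk, S.α_eq_β k i hk, crossPart_comm hk]
    · rw [Finset.sum_eq_single i (fun k _ hk => by simp [hk]) (by simp)]
      simp
  rw [h1, h2, h3, nehariPart]
  field_simp

theorem mem_nehari_iff (hN : 1 ≤ N) (hemb : S.SobolevEmbedding) (hcoer : S.Coercive) (u : S.HM) :
    u ∈ S.nehari ↔ ∀ i, u i ≠ 0 ∧ S.nehariPart i u = 0 := by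
  simp only [← fderiv_J_single hN hemb hcoer]
  rfl

end CompetitiveSystem

/-! ### The reduced Nehari system and its maximum principle. -/

section Reduced

variable {M : ℕ}

/-- With `s_i = e^{τ_i}`, the left-hand side of the Nehari equations for `su`, divided by
`s_i^p`; here `r = p - 2`. -/
def reducedNehari (r : ℝ) (α : Fin M → Fin M → ℝ) (A a : Fin M → ℝ) (b : Fin M → Fin M → ℝ)
    (τ : Fin M → ℝ) (i : Fin M) : ℝ :=
  A i * Real.exp (-r * τ i) - a i +
    ∑ j ∈ Finset.univ.filter (fun j => j ≠ i), b i j * Real.exp (α i j * (τ j - τ i))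

/-- Take `i` maximizing `τ_i - σ_i`. Then `τ_j - τ_i ≤ σ_j - σ_i` for all `j`, so no coupling term
is larger for `τ`; a positive maximum would make the `A_i` term strictly smaller, and both equations
could not vanish. -/
theorem le_of_reducedNehari_eq_zero {r : ℝ} (hr : 0 < r) {α : Fin M → Fin M → ℝ}
    (hα : ∀ i j, i ≠ j → 0 < α i j) {A a : Fin M → ℝ} (hA : ∀ i, 0 < A i)
    {b : Fin M → Fin M → ℝ} (hb : ∀ i j, i ≠ j → 0 ≤ b i j) {τ σ : Fin M → ℝ}
    (hτ : reducedNehari r α A a b τ = 0) (hσ : reducedNehari r α A a b σ = 0) (k : Fin M) :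
    τ k ≤ σ k := by
  have : Nonempty (Fin M) := ⟨k⟩
  obtain ⟨i, hi⟩ := Finite.exists_max fun i => τ i - σ i
  by_contra hk
  have hpos : 0 < τ i - σ i := by linarith [hi k, not_le.1 hk]
  have h1 : reducedNehari r α A a b τ i < reducedNehari r α A a b σ i := by
    unfold reducedNehari
    refine add_lt_add_of_lt_of_le (sub_lt_sub_right (mul_lt_mul_of_pos_left
      (Real.exp_lt_exp.2 (by nlinarith)) (hA i)) _) (Finset.sum_le_sum fun j hj => ?_)
    have hij : i ≠ j := (Finset.mem_filter.1 hj).2.symm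
    refine mul_le_mul_of_nonneg_left (Real.exp_le_exp.2
      (mul_le_mul_of_nonneg_left ?_ (hα i j hij).le)) (hb i j hij)
    linarith [hi j]
  rw [hτ, hσ] at h1
  exact lt_irrefl _ h1

theorem eq_of_reducedNehari_eq_zero {r : ℝ} (hr : 0 < r) {α : Fin M → Fin M → ℝ}
    (hα : ∀ i j, i ≠ j → 0 < α i j) {A a : Fin M → ℝ} (hA : ∀ i, 0 < A i)
    {b : Fin M → Fin M → ℝ} (hb : ∀ i j, i ≠ j → 0 ≤ b i j) {τ σ : Fin M → ℝ}
    (hτ : reducedNehari r α A a b τ = 0) (hσ : reducedNehari r α A a b σ = 0) : τ = σ :=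
  funext fun k => le_antisymm (le_of_reducedNehari_eq_zero hr hα hA hb hτ hσ k)
    (le_of_reducedNehari_eq_zero hr hα hA hb hσ hτ k)

theorem hasDerivAt_reducedNehari_line (r : ℝ) (α : Fin M → Fin M → ℝ) (A a : Fin M → ℝ)
    (b : Fin M → Fin M → ℝ) (τ v : Fin M → ℝ) (i : Fin M) :
    HasDerivAt (fun t : ℝ => reducedNehari r α A a b (τ + t • v) i)
      (-(r * (A i * Real.exp (-r * τ i))) * v i +
        ∑ j ∈ Finset.univ.filter (fun j => j ≠ i),
          α i j * (b i j * Real.exp (α i j * (τ j - τ i))) * (v j - v i)) 0 := by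
  have hl : ∀ k, HasDerivAt (fun t : ℝ => (τ + t • v) k) (v k) 0 := fun k => by
    simpa using ((hasDerivAt_id (0 : ℝ)).mul_const (v k)).const_add (τ k)
  unfold reducedNehari
  refine HasDerivAt.add ?_ (HasDerivAt.fun_sum fun j _ => ?_)
  · have := ((((hl i).const_mul (-r)).exp).const_mul (A i)).sub_const (a i)
    refine this.congr_deriv ?_
    simp
    ring
  · have := ((((hl j).sub (hl i)).const_mul (α i j)).exp).const_mul (b i j)
    refine this.congr_deriv ?_
    simp
    ring

/-- At an index where `v` is maximal the coupling sum is nonpositive, so the equation forces that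
maximum to be at most 0. -/
theorem nonpos_of_linearized_eq_zero {c : Fin M → Fin M → ℝ} {d : Fin M → ℝ}
    (hd : ∀ i, 0 < d i) (hc : ∀ i j, i ≠ j → 0 ≤ c i j) {v : Fin M → ℝ}
    (hv : ∀ i, -d i * v i + ∑ j ∈ Finset.univ.filter (fun j => j ≠ i), c i j * (v j - v i) = 0)
    (k : Fin M) : v k ≤ 0 := by
  have : Nonempty (Fin M) := ⟨k⟩
  obtain ⟨i, hi⟩ := Finite.exists_max v
  have h1 : ∑ j ∈ Finset.univ.filter (fun j => j ≠ i), c i j * (v j - v i) ≤ 0 :=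
    Finset.sum_nonpos fun j hj => mul_nonpos_of_nonneg_of_nonpos
      (hc i j (Finset.mem_filter.1 hj).2.symm) (by linarith [hi j])
  have h2 := hv i
  have h3 : v i ≤ 0 := by
    by_contra h
    nlinarith [hd i, mul_pos (hd i) (not_le.1 h)]
  exact (hi k).trans h3

theorem eq_zero_of_linearized_eq_zero {c : Fin M → Fin M → ℝ} {d : Fin M → ℝ}
    (hd : ∀ i, 0 < d i) (hc : ∀ i j, i ≠ j → 0 ≤ c i j) {v : Fin M → ℝ}
    (hv : ∀ i, -d i * v i + ∑ j ∈ Finset.univ.filter (fun j => j ≠ i), c i j * (v j - v i) = 0) :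
    v = 0 := by
  refine funext fun k => le_antisymm (nonpos_of_linearized_eq_zero hd hc hv k) ?_
  have := nonpos_of_linearized_eq_zero (v := -v) hd hc (fun i => by
    have h := hv i
    have e : ∑ j ∈ Finset.univ.filter (fun j => j ≠ i), c i j * ((-v) j - (-v) i) =
        -∑ j ∈ Finset.univ.filter (fun j => j ≠ i), c i j * (v j - v i) := by
      rw [← Finset.sum_neg_distrib]
      refine Finset.sum_congr rfl fun j _ => ?_
      simp only [Pi.neg_apply]
      ring
    rw [e, Pi.neg_apply]
    linarith) k
  simpa using this

theorem ContinuousLinearMap.isInvertible_of_injective {V : Type*} [NormedAddCommGroup V]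
    [NormedSpace ℝ V] [FiniteDimensional ℝ V] (D : V →L[ℝ] V) (h : Function.Injective D) :
    D.IsInvertible := by
  refine ⟨(LinearEquiv.ofInjectiveEndo (D : V →ₗ[ℝ] V) h).toContinuousLinearEquiv, ?_⟩
  ext v
  rfl

/-- Implicit function theorem in `τ`. The partial derivative is an injective endomorphism of `ℝ^M`
by the linear maximum principle, hence invertible; the signs of the coefficients are needed only at
`u₀`. -/
theorem exists_contDiffAt_reducedNehari_eq_zero {Y : Type*} [NormedAddCommGroup Y]
    [NormedSpace ℝ Y] [CompleteSpace Y] {r : ℝ} (hr : 0 < r) {α : Fin M → Fin M → ℝ}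
    (hα : ∀ i j, i ≠ j → 0 < α i j) {A a : Fin M → Y → ℝ} {b : Fin M → Fin M → Y → ℝ}
    (hA : ∀ i, ContDiff ℝ 1 (A i)) (ha : ∀ i, ContDiff ℝ 1 (a i))
    (hb : ∀ i j, i ≠ j → ContDiff ℝ 1 (b i j)) {u₀ : Y} (hA0 : ∀ i, 0 < A i u₀)
    (hb0 : ∀ i j, i ≠ j → 0 ≤ b i j u₀) {τ₀ : Fin M → ℝ}
    (h0 : reducedNehari r α (fun i => A i u₀) (fun i => a i u₀) (fun i j => b i j u₀) τ₀ = 0) :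
    ∃ τ : Y → Fin M → ℝ, ContDiffAt ℝ 1 τ u₀ ∧
      ∀ᶠ u in 𝓝 u₀,
        reducedNehari r α (fun i => A i u) (fun i => a i u) (fun i j => b i j u) (τ u) = 0 := by
  let f : Y × (Fin M → ℝ) → (Fin M → ℝ) := fun z =>
    reducedNehari r α (fun i => A i z.1) (fun i => a i z.1) (fun i j => b i j z.1) z.2
  have hτ : ∀ k, ContDiff ℝ 1 fun z : Y × (Fin M → ℝ) => z.2 k := fun k =>
    (contDiff_apply ℝ ℝ k).comp contDiff_snd
  have hf : ContDiff ℝ 1 f := by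
    refine contDiff_pi.2 fun i => ?_
    refine ContDiff.add (ContDiff.sub (((hA i).comp contDiff_fst).mul
      ((contDiff_const.mul (hτ i)).exp)) ((ha i).comp contDiff_fst)) (ContDiff.sum fun j hj => ?_)
    exact ((hb i j (Finset.mem_filter.1 hj).2.symm).comp contDiff_fst).mul
      ((contDiff_const.mul ((hτ j).sub (hτ i))).exp)
  have hinv : (fderiv ℝ f (u₀, τ₀) ∘L .inr ℝ Y (Fin M → ℝ)).IsInvertible := by
    refine ContinuousLinearMap.isInvertible_of_injective _
      ((injective_iff_map_eq_zero _).2 fun v hv => ?_)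
    -- A kernel vector gives zero derivative along the line `τ₀ + t v`; comparing with the explicit
    -- derivative turns this into the linearized system.
    have hline : HasDerivAt (fun t : ℝ => f (u₀, τ₀ + t • v)) 0 0 := by
      rw [← hv]
      have h1 : HasDerivAt (fun t : ℝ => (u₀, τ₀ + t • v)) ((0 : Y), v) 0 := by
        refine (hasDerivAt_const (0 : ℝ) u₀).prodMk ?_
        simpa using ((hasDerivAt_id (0 : ℝ)).smul_const v).const_add τ₀
      have h2 : HasFDerivAt f (fderiv ℝ f (u₀, τ₀)) ((fun t : ℝ => (u₀, τ₀ + t • v)) 0) := by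
        have : (fun t : ℝ => (u₀, τ₀ + t • v)) 0 = (u₀, τ₀) := by simp
        rw [this]
        exact (hf.differentiable one_ne_zero _).hasFDerivAt
      exact h2.comp_hasDerivAt (0 : ℝ) h1
    refine eq_zero_of_linearized_eq_zero
      (d := fun i => r * (A i u₀ * Real.exp (-r * τ₀ i)))
      (c := fun i j => α i j * (b i j u₀ * Real.exp (α i j * (τ₀ j - τ₀ i))))
      (fun i => mul_pos hr (mul_pos (hA0 i) (Real.exp_pos _)))
      (fun i j hij => mul_nonneg (hα i j hij).le (mul_nonneg (hb0 i j hij) (Real.exp_pos _).le))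
      fun i => ?_
    exact (hasDerivAt_reducedNehari_line r α (fun i => A i u₀) (fun i => a i u₀)
      (fun i j => b i j u₀) τ₀ v i).unique (hasDerivAt_pi.1 hline i)
  have hfa : ContDiffAt ℝ 1 f (u₀, τ₀) := hf.contDiffAt
  refine ⟨hfa.implicitFunction one_ne_zero hinv,
    hfa.contDiffAt_implicitFunction one_ne_zero hinv, ?_⟩
  filter_upwards [hfa.eventually_apply_implicitFunction one_ne_zero hinv] with u hu
  exact hu.trans h0

end Reduced

/-! ### Uniqueness and smooth dependence of `s_u`. -/

namespace CompetitiveSystem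

variable {N M : ℕ} {S : CompetitiveSystem N M}

/-- With `s = e^τ`, `s_i^2 = s_i^p s_i^{-(p-2)}` and `s_j^α s_i^β = s_i^p (s_j/s_i)^α`, the latter
because `α + β = p`. -/
theorem nehariPart_scale_exp (hcoer : S.Coercive) (u : S.HM) (τ : Fin M → ℝ) (i : Fin M) :
    S.nehariPart i (S.scale (fun k => Real.exp (τ k)) u) = Real.exp (τ i) ^ S.p *
      reducedNehari (S.p - 2) S.α (fun i => S.quadPart i u) (fun i => S.selfPart i u)
        (fun i j => S.β i j * S.crossPart i j u) τ i := by
  unfold nehariPart reducedNehari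
  rw [quadPart_scale hcoer, selfPart_scale, mul_add, mul_sub, Finset.mul_sum]
  congr 1
  · rw [abs_of_pos (Real.exp_pos _), ← Real.exp_mul, mul_left_comm, ← Real.exp_add,
      ← Real.exp_nat_mul]
    have : τ i * S.p + -(S.p - 2) * τ i = ((2 : ℕ) : ℝ) * τ i := by
      push_cast
      ring
    rw [this]
    ring
  · refine Finset.sum_congr rfl fun j hj => ?_
    rw [crossPart_scale, abs_of_pos (Real.exp_pos _), abs_of_pos (Real.exp_pos _),
      ← Real.exp_mul, ← Real.exp_mul, ← Real.exp_mul, ← Real.exp_add,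
      ← S.α_add_β i j (Finset.mem_filter.1 hj).2.symm]
    have : τ j * S.α i j + τ i * S.β i j =
        τ i * (S.α i j + S.β i j) + S.α i j * (τ j - τ i) := by ring
    rw [this, Real.exp_add]
    ring

theorem scale_exp_mem_nehari_iff (hN : 1 ≤ N) (hemb : S.SobolevEmbedding) (hcoer : S.Coercive)
    (u : S.HM) (τ : Fin M → ℝ) :
    S.scale (fun k => Real.exp (τ k)) u ∈ S.nehari ↔ (∀ i, u i ≠ 0) ∧
      reducedNehari (S.p - 2) S.α (fun i => S.quadPart i u) (fun i => S.selfPart i u)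
        (fun i j => S.β i j * S.crossPart i j u) τ = 0 := by
  rw [mem_nehari_iff hN hemb hcoer, forall_and]
  refine and_congr (forall_congr' fun i => ?_) ?_
  · exact smul_ne_zero_iff.trans (and_iff_right (Real.exp_pos _).ne')
  · rw [funext_iff]
    refine forall_congr' fun i => ?_
    rw [nehariPart_scale_exp hcoer, mul_eq_zero]
    exact or_iff_right (Real.rpow_pos_of_pos (Real.exp_pos _) _).ne'

theorem exp_log_eq {s : Fin M → ℝ} (hs : ∀ i, 0 < s i) :
    (fun k => Real.exp (Real.log (s k))) = s :=
  funext fun k => Real.exp_log (hs k)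

theorem eq_of_scale_mem_nehari (hN : 1 ≤ N) (hemb : S.SobolevEmbedding) (hcoer : S.Coercive)
    {u : S.HM} {s t : Fin M → ℝ} (hs : ∀ i, 0 < s i) (ht : ∀ i, 0 < t i)
    (hsu : S.scale s u ∈ S.nehari) (htu : S.scale t u ∈ S.nehari) : s = t := by
  rw [← exp_log_eq hs, scale_exp_mem_nehari_iff hN hemb hcoer] at hsu
  rw [← exp_log_eq ht, scale_exp_mem_nehari_iff hN hemb hcoer] at htu
  have := eq_of_reducedNehari_eq_zero (by linarith [S.two_lt_p])
    (fun i j h => by linarith [S.one_lt_α i j h])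
    (fun i => innerI_self_pos hemb hcoer i (hsu.1 i))
    (fun i j h => mul_nonneg (by linarith [S.one_lt_β i j h]) (crossPart_nonneg h u)) hsu.2 htu.2
  rw [← exp_log_eq hs, ← exp_log_eq ht]
  funext k
  rw [congr_fun this k]

theorem existsUnique_scale_mem_nehari (hN : 1 ≤ N) (hemb : S.SobolevEmbedding)
    (hcoer : S.Coercive) {u : S.HM} (hu : u ∈ S.Utilde) :
    ∃! s : Fin M → ℝ, (∀ i, 0 < s i) ∧ S.scale s u ∈ S.nehari := by
  obtain ⟨s, hs, h⟩ := hu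
  exact ⟨s, ⟨hs, h⟩, fun t ht => eq_of_scale_mem_nehari hN hemb hcoer ht.1 hs ht.2 h⟩

theorem sOf_spec {u : S.HM} (hu : u ∈ S.Utilde) :
    (∀ i, 0 < S.sOf u i) ∧ S.scale (S.sOf u) u ∈ S.nehari := by
  have h : ∃ s : Fin M → ℝ, (∀ i, 0 < s i) ∧ S.scale s u ∈ S.nehari := hu
  unfold sOf
  rw [dif_pos h]
  exact h.choose_spec

theorem sOf_eq (hN : 1 ≤ N) (hemb : S.SobolevEmbedding) (hcoer : S.Coercive) {u : S.HM}
    {s : Fin M → ℝ} (hs : ∀ i, 0 < s i) (h : S.scale s u ∈ S.nehari) : S.sOf u = s :=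
  have hu := sOf_spec ⟨s, hs, h⟩
  eq_of_scale_mem_nehari hN hemb hcoer hu.1 hs hu.2 h

/-- Uniqueness identifies the chosen `sOf` with the exponential of the implicit function on a whole
neighbourhood in `ℋ`, so `sOf` inherits its regularity. -/
theorem eventually_mem_Utilde_and_contDiffAt_sOf (hN : 1 ≤ N) (hemb : S.SobolevEmbedding)
    (hcoer : S.Coercive) {u₀ : S.HM} (hu₀ : u₀ ∈ S.Utilde) :
    (∀ᶠ u in 𝓝 u₀, u ∈ S.Utilde) ∧ ContDiffAt ℝ 1 S.sOf u₀ := by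
  obtain ⟨s, hs, h⟩ := id hu₀
  rw [← exp_log_eq hs, scale_exp_mem_nehari_iff hN hemb hcoer] at h
  obtain ⟨τ, hτ, hev⟩ := exists_contDiffAt_reducedNehari_eq_zero (Y := S.HM)
    (A := S.quadPart) (a := S.selfPart) (b := fun i j u => S.β i j * S.crossPart i j u)
    (by linarith [S.two_lt_p])
    (fun i j h => by linarith [S.one_lt_α i j h]) (contDiff_quadPart hcoer)
    (contDiff_selfPart hN) (fun i j hij => contDiff_const.mul (contDiff_crossPart hN hij))
    (fun i => innerI_self_pos hemb hcoer i (h.1 i))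
    (fun i j h => mul_nonneg (by linarith [S.one_lt_β i j h]) (crossPart_nonneg h u₀)) h.2
  have hne : ∀ᶠ u in 𝓝 u₀, ∀ i, u i ≠ 0 :=
    eventually_all.2 fun i => (continuous_apply i).continuousAt.eventually_ne (h.1 i)
  have hmem : ∀ᶠ u in 𝓝 u₀, S.scale (fun k => Real.exp (τ u k)) u ∈ S.nehari := by
    filter_upwards [hev, hne] with u h1 h2
    exact (scale_exp_mem_nehari_iff hN hemb hcoer _ _).2 ⟨h2, h1⟩
  constructor
  · filter_upwards [hmem] with u hu
    exact ⟨_, fun _ => Real.exp_pos _, hu⟩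
  · have h1 : ContDiffAt ℝ 1 (fun u => fun k => Real.exp (τ u k)) u₀ :=
      contDiffAt_pi.2 fun k => (contDiffAt_pi.1 hτ k).exp
    refine h1.congr_of_eventuallyEq ?_
    filter_upwards [hmem] with u hu
    exact sOf_eq hN hemb hcoer (fun _ => Real.exp_pos _) hu

end CompetitiveSystem

/-! ### The map `m` and the derivative of `Ψ`. -/

namespace CompetitiveSystem

variable {N M : ℕ} {S : CompetitiveSystem N M}

theorem isOpen_Utilde (hN : 1 ≤ N) (hemb : S.SobolevEmbedding) (hcoer : S.Coercive) :
    IsOpen S.Utilde :=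
  isOpen_iff_mem_nhds.2 fun _ hu =>
    (eventually_mem_Utilde_and_contDiffAt_sOf hN hemb hcoer hu).1

theorem isOpen_preimage_U (hN : 1 ≤ N) (hemb : S.SobolevEmbedding) (hcoer : S.Coercive) :
    IsOpen ((Subtype.val : S.T → S.HM) ⁻¹' S.U) := by
  have h := (isOpen_Utilde hN hemb hcoer).preimage (continuous_subtype_val (p := (· ∈ S.T)))
  convert h using 1
  ext u
  exact and_iff_left u.2

theorem m_mem_nehari {u : S.HM} (hu : u ∈ S.Utilde) : S.m u ∈ S.nehari :=
  (sOf_spec hu).2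

theorem mem_T_iff {u : S.HM} :
    u ∈ S.T ↔ ∀ i, S.quadPart i u = 1 := by
  refine forall_congr' fun i => ?_
  rw [quadPart, normI, Real.sqrt_eq_one]

theorem scale_scale (s t : Fin M → ℝ) (u : S.HM) :
    S.scale s (S.scale t u) = S.scale (fun i => s i * t i) u :=
  funext fun _ => smul_smul _ _ _

theorem scale_one (u : S.HM) : S.scale (fun _ => 1) u = u :=
  funext fun _ => one_smul _ _

theorem quadPart_m (hcoer : S.Coercive) {u : S.HM} (hu : u ∈ S.T)
    (i : Fin M) : S.quadPart i (S.m u) = S.sOf u i ^ 2 := by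
  rw [m, quadPart_scale hcoer, (mem_T_iff).1 hu i, mul_one]

/-- On `𝒯` the `i`-th component of `m u` has norm `s_i`, so `m u` determines `s_u` and then `u`; the
preimage of `w` is obtained by normalizing each component. -/
theorem bijOn_m (hN : 1 ≤ N) (hemb : S.SobolevEmbedding) (hcoer : S.Coercive) :
    Set.BijOn S.m S.U S.nehari := by
  refine ⟨fun u hu => m_mem_nehari hu.1, fun u hu w hw h => ?_, fun w hw => ?_⟩
  · have hs : S.sOf u = S.sOf w := by
      funext i
      have h1 : S.sOf u i ^ 2 = S.sOf w i ^ 2 := by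
        rw [← quadPart_m hcoer hu.2, ← quadPart_m hcoer hw.2, h]
      exact (pow_left_inj₀ ((sOf_spec hu.1).1 i).le ((sOf_spec hw.1).1 i).le two_ne_zero).1 h1
    funext i
    have h2 := congr_fun h i
    unfold m scale at h2
    rw [hs] at h2
    exact smul_right_injective _ ((sOf_spec hw.1).1 i).ne' h2
  · have hne : ∀ i, w i ≠ 0 := fun i => (hw i).1
    have hq : ∀ i, 0 < S.quadPart i w := fun i => innerI_self_pos hemb hcoer i (hne i)
    set r : Fin M → ℝ := fun i => Real.sqrt (S.quadPart i w) with hr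
    have hr0 : ∀ i, 0 < r i := fun i => Real.sqrt_pos.2 (hq i)
    have hw' : S.scale r (S.scale (fun i => (r i)⁻¹) w) = w := by
      rw [scale_scale]
      simp only [mul_inv_cancel₀ (hr0 _).ne']
      exact scale_one w
    have hn : S.scale r (S.scale (fun i => (r i)⁻¹) w) ∈ S.nehari := hw'.symm ▸ hw
    refine ⟨S.scale (fun i => (r i)⁻¹) w, ⟨⟨r, hr0, hn⟩, ?_⟩, ?_⟩
    · rw [mem_T_iff]
      intro i
      rw [quadPart_scale hcoer, inv_pow, hr, Real.sq_sqrt (hq i).le, inv_mul_cancel₀ (hq i).ne']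
    · rw [m, sOf_eq hN hemb hcoer hr0 hn, hw']

theorem contDiffAt_m (hN : 1 ≤ N) (hemb : S.SobolevEmbedding) (hcoer : S.Coercive) {u : S.HM}
    (hu : u ∈ S.Utilde) : ContDiffAt ℝ 1 S.m u :=
  contDiffAt_pi.2 fun i =>
    (contDiffAt_pi.1 (eventually_mem_Utilde_and_contDiffAt_sOf hN hemb hcoer hu).2 i).smul
      (contDiff_apply ℝ S.H i).contDiffAt

theorem contDiffAt_Psi (hN : 1 ≤ N) (hemb : S.SobolevEmbedding) (hcoer : S.Coercive) {u : S.HM}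
    (hu : u ∈ S.Utilde) : ContDiffAt ℝ 1 S.Psi u :=
  (contDiff_J hN hemb hcoer).contDiffAt.comp u (contDiffAt_m hN hemb hcoer hu)

/-- These directions are combinations of those in which the definition of the Nehari set makes the
derivative vanish. -/
theorem fderiv_J_m_scale {u : S.HM} (hu : u ∈ S.Utilde) (c : Fin M → ℝ) :
    fderiv ℝ S.J (S.m u) (S.scale c u) = 0 := by
  have e : S.scale c u = ∑ i, (c i / S.sOf u i) • (Pi.single i (S.m u i) : S.HM) := by
    funext k
    rw [Finset.sum_apply, Finset.sum_eq_single k]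
    · have h : c k • u k = (c k / S.sOf u k) • S.sOf u k • u k := by
        rw [smul_smul, div_mul_cancel₀ _ ((sOf_spec hu).1 k).ne']
      simpa [m, scale] using h
    · intro i _ hi
      simp [hi.symm]
    · simp
  rw [e, map_sum]
  refine Finset.sum_eq_zero fun i _ => ?_
  rw [map_smul, (m_mem_nehari hu i).2, smul_zero]

/-- The product rule splits `m'(u) v` into `s_u v` and a componentwise multiple of `u`; `J'(m u)`
kills the second. -/
theorem fderiv_Psi (hN : 1 ≤ N) (hemb : S.SobolevEmbedding) (hcoer : S.Coercive) {u : S.HM}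
    (hu : u ∈ S.Utilde) (v : S.HM) :
    fderiv ℝ S.Psi u v = fderiv ℝ S.J (S.m u) (S.scale (S.sOf u) v) := by
  have hs := ((eventually_mem_Utilde_and_contDiffAt_sOf hN hemb hcoer hu).2.differentiableAt
    one_ne_zero).hasFDerivAt
  have hm := ((contDiffAt_m hN hemb hcoer hu).differentiableAt one_ne_zero).hasFDerivAt
  have hJ := ((contDiff_J hN hemb hcoer).differentiable one_ne_zero (S.m u)).hasFDerivAt
  have e : fderiv ℝ S.m u v = S.scale (S.sOf u) v + S.scale (fderiv ℝ S.sOf u v) u := by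
    funext i
    have h1 := (hasFDerivAt_pi'.1 hs i).smul (hasFDerivAt_apply (𝕜 := ℝ) i u)
    have h2 := (hasFDerivAt_pi'.1 hm i).unique h1
    have h3 := congr_arg (fun D : S.HM →L[ℝ] S.H => D v) h2
    exact h3
  have hP : fderiv ℝ S.Psi u v = fderiv ℝ S.J (S.m u) (fderiv ℝ S.m u v) := by
    have h : HasFDerivAt S.Psi ((fderiv ℝ S.J (S.m u)).comp (fderiv ℝ S.m u)) u := hJ.comp u hm
    rw [h.fderiv]
    rfl
  rw [hP, e, map_add, fderiv_J_m_scale hu, add_zero]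

theorem innerI_add_smul (hcoer : S.Coercive) (i : Fin M) (v w : S.H) (t : ℝ) :
    S.innerI i (v + t • w) (v + t • w) =
      S.innerI i v v + 2 * t * S.innerI i v w + t ^ 2 * S.innerI i w w := by
  obtain ⟨B, hB⟩ := S.exists_innerI_eq hcoer i
  have hc : B w v = B v w := by rw [hB, hB, innerI_comm]
  simp only [← hB, map_add, map_smul, add_apply, smul_apply, smul_eq_mul, hc]
  ring

/-- Normalize `u + t v`. By tangency the squared norm of its `i`-th component is `1 + t² ‖v_i‖_i²`,
so normalizing does not change the velocity at 0. -/
theorem exists_curve (hN : 1 ≤ N) (hemb : S.SobolevEmbedding) (hcoer : S.Coercive) {u v : S.HM}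
    (hu : u ∈ S.U) (hv : v ∈ S.tangent u) :
    ∃ γ : ℝ → S.HM, γ 0 = u ∧ HasDerivAt γ v 0 ∧ ∀ᶠ t in 𝓝 0, γ t ∈ S.U := by
  set b : Fin M → ℝ := fun i => S.innerI i (v i) (v i)
  have hb : ∀ i, 0 ≤ b i := fun i => innerI_self_nonneg hemb hcoer i _
  have hpos : ∀ i (t : ℝ), 0 < 1 + t ^ 2 * b i := fun i t => by
    have := mul_nonneg (sq_nonneg t) (hb i)
    linarith
  let γ : ℝ → S.HM := fun t => S.scale (fun i => (Real.sqrt (1 + t ^ 2 * b i))⁻¹) (u + t • v)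
  have h0 : γ 0 = u := by
    funext i
    simp [γ, scale]
  have hd : HasDerivAt γ v 0 := by
    refine hasDerivAt_pi.2 fun i => ?_
    have h1 : HasDerivAt (fun t : ℝ => (Real.sqrt (1 + t ^ 2 * b i))⁻¹) 0 0 := by
      have h2 : HasDerivAt (fun t : ℝ => 1 + t ^ 2 * b i) 0 0 := by
        simpa using (((hasDerivAt_id (0 : ℝ)).pow 2).mul_const (b i)).const_add 1
      have h3 := (h2.sqrt (hpos i 0).ne').inv (Real.sqrt_pos.2 (hpos i 0)).ne'
      refine h3.congr_deriv ?_
      simp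
    have h4 : HasDerivAt (fun t : ℝ => u i + t • v i) (v i) 0 := by
      simpa using ((hasDerivAt_id (0 : ℝ)).smul_const (v i)).const_add (u i)
    refine (h1.smul h4).congr_deriv ?_
    simp
  refine ⟨γ, h0, hd, ?_⟩
  have hU : ∀ᶠ t in 𝓝 (0 : ℝ), γ t ∈ S.Utilde :=
    hd.continuousAt.eventually_mem ((isOpen_Utilde hN hemb hcoer).mem_nhds (h0.symm ▸ hu.1))
  filter_upwards [hU] with t ht
  refine ⟨ht, (mem_T_iff).2 fun i => ?_⟩
  have hq : S.quadPart i (u + t • v) = 1 + t ^ 2 * b i := by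
    have h1 : S.innerI i (u i) (u i) = 1 := (mem_T_iff).1 hu.2 i
    have h2 : S.innerI i (u i) (v i) = 0 := hv i
    have := innerI_add_smul hcoer i (u i) (v i) t
    rw [h1, h2] at this
    rw [quadPart, Pi.add_apply, Pi.smul_apply]
    linarith
  rw [quadPart_scale hcoer, hq, inv_pow, Real.sq_sqrt (hpos i t).le, inv_mul_cancel₀ (hpos i t).ne']

/-- A derivative within `U` need not be unique on `ℋ`, but on velocities of curves in `U` it must
agree with the full derivative; tangent vectors are such velocities. -/
theorem dPsi_apply (hN : 1 ≤ N) (hemb : S.SobolevEmbedding) (hcoer : S.Coercive) {u v : S.HM}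
    (hu : u ∈ S.U) (hv : v ∈ S.tangent u) :
    S.dPsi u v = fderiv ℝ S.J (S.m u) (S.scale (S.sOf u) v) := by
  obtain ⟨γ, h0, hd, hγ⟩ := exists_curve hN hemb hcoer hu hv
  rw [← fderiv_Psi hN hemb hcoer hu.1]
  have hdiff := (contDiffAt_Psi hN hemb hcoer hu.1).differentiableAt one_ne_zero
  have h1 : HasDerivAt (S.Psi ∘ γ) (fderiv ℝ S.Psi u v) 0 := by
    refine HasFDerivAt.comp_hasDerivAt (0 : ℝ) ?_ hd
    rw [h0]
    exact hdiff.hasFDerivAt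
  have h2 : HasDerivAt (S.Psi ∘ γ) (S.dPsi u v) 0 := by
    have h3 : HasFDerivWithinAt S.Psi (S.dPsi u) S.U (γ 0) := by
      rw [h0]
      exact hdiff.differentiableWithinAt.hasFDerivWithinAt
    have h4 := h3.comp_hasDerivWithinAt (0 : ℝ) (s := {t | γ t ∈ S.U}) hd.hasDerivWithinAt
      (fun t ht => ht)
    exact h4.hasDerivAt hγ
  exact h2.unique h1

/-! ### Energy on the Nehari set and two-sided bounds for `s_u`. -/

/-- Symmetrizing, `∑ β_ij` times the interactions equals `p/2` times their sum, so adding the Nehari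
equations cancels the interactions from `J`. -/
theorem J_eq_of_mem_nehari (hN : 1 ≤ N) (hemb : S.SobolevEmbedding) (hcoer : S.Coercive)
    {w : S.HM} (hw : w ∈ S.nehari) : S.J w = (1 / 2 - 1 / S.p) * ∑ i, S.quadPart i w := by
  have h1 : ∀ i, S.selfPart i w = S.quadPart i w +
      ∑ j ∈ Finset.univ.filter (fun j => j ≠ i), S.β i j * S.crossPart i j w := fun i => by
    have := ((mem_nehari_iff hN hemb hcoer w).1 hw i).2
    unfold nehariPart at this
    linarith
  have h2 : ∑ i, ∑ j ∈ Finset.univ.filter (fun j => j ≠ i), S.β i j * S.crossPart i j w =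
      ∑ i, ∑ j ∈ Finset.univ.filter (fun j => j ≠ i), S.α i j * S.crossPart i j w := by
    simp only [Finset.sum_filter]
    rw [Finset.sum_comm]
    refine Finset.sum_congr rfl fun i _ => Finset.sum_congr rfl fun j _ => ?_
    by_cases h : i = j
    · simp [h]
    · rw [if_pos h, if_pos (Ne.symm h), S.α_eq_β i j h, crossPart_comm h]
  have h3 : ∑ i, ∑ j ∈ Finset.univ.filter (fun j => j ≠ i), S.α i j * S.crossPart i j w +
      ∑ i, ∑ j ∈ Finset.univ.filter (fun j => j ≠ i), S.β i j * S.crossPart i j w =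
      S.p * ∑ i, ∑ j ∈ Finset.univ.filter (fun j => j ≠ i), S.crossPart i j w := by
    simp only [← Finset.sum_add_distrib, Finset.mul_sum]
    refine Finset.sum_congr rfl fun i _ => Finset.sum_congr rfl fun j hj => ?_
    rw [← add_mul, S.α_add_β i j (Finset.mem_filter.1 hj).2.symm]
  have hp : S.p ≠ 0 := by linarith [S.two_lt_p]
  rw [J_eq hemb hcoer, Finset.sum_congr rfl fun i _ => h1 i, Finset.sum_add_distrib]
  rw [← h2] at h3
  have h4 : ∑ i, ∑ j ∈ Finset.univ.filter (fun j => j ≠ i), S.β i j * S.crossPart i j w =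
      S.p / 2 * ∑ i, ∑ j ∈ Finset.univ.filter (fun j => j ≠ i), S.crossPart i j w := by linarith
  rw [h4]
  field_simp
  ring

/-- Repulsion has a favourable sign, so the `i`-th equation gives `‖w_i‖_i² ≤ C ‖w_i‖_i^p`; divide,
using `p > 2`. -/
theorem exists_quadPart_ge (hN : 1 ≤ N) (hemb : S.SobolevEmbedding) (hcoer : S.Coercive) :
    ∃ δ : ℝ, 0 < δ ∧ ∀ w ∈ S.nehari, ∀ i, δ ^ 2 ≤ S.quadPart i w := by
  obtain ⟨C, hC, h⟩ := exists_selfPart_le hN hemb hcoer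
  have hp : 0 < S.p - 2 := by linarith [S.two_lt_p]
  refine ⟨(1 / C) ^ (1 / (S.p - 2)), by positivity, fun w hw i => ?_⟩
  obtain ⟨hne, hz⟩ := (mem_nehari_iff hN hemb hcoer w).1 hw i
  have hq : 0 < S.quadPart i w := innerI_self_pos hemb hcoer i hne
  have hs : 0 ≤ ∑ j ∈ Finset.univ.filter (fun j => j ≠ i), S.β i j * S.crossPart i j w :=
    Finset.sum_nonneg fun j hj => by
      have hij := (Finset.mem_filter.1 hj).2.symm
      exact mul_nonneg (by linarith [S.one_lt_β i j hij]) (crossPart_nonneg hij w)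
  have h1 : S.quadPart i w ≤ C * S.quadPart i w ^ (S.p / 2) := by
    unfold nehariPart at hz
    linarith [h i w]
  have h2 : 1 / C ≤ S.quadPart i w ^ ((S.p - 2) / 2) := by
    have e : S.quadPart i w ^ (S.p / 2) = S.quadPart i w ^ ((S.p - 2) / 2) * S.quadPart i w := by
      rw [← Real.rpow_add_one hq.ne']
      congr 1
      ring
    rw [e, ← mul_assoc] at h1
    rw [div_le_iff₀ hC, mul_comm]
    by_contra hlt
    nlinarith [not_le.1 hlt]
  calc ((1 / C) ^ (1 / (S.p - 2))) ^ 2 = (1 / C) ^ (2 / (S.p - 2)) := by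
        rw [← Real.rpow_natCast, ← Real.rpow_mul (by positivity)]
        congr 1
        push_cast
        ring
    _ ≤ (S.quadPart i w ^ ((S.p - 2) / 2)) ^ (2 / (S.p - 2)) := by gcongr
    _ = S.quadPart i w := by
        rw [← Real.rpow_mul hq.le]
        have : (S.p - 2) / 2 * (2 / (S.p - 2)) = 1 := by field_simp
        rw [this, Real.rpow_one]

theorem exists_sOf_ge (hN : 1 ≤ N) (hemb : S.SobolevEmbedding) (hcoer : S.Coercive) :
    ∃ δ : ℝ, 0 < δ ∧ ∀ u ∈ S.U, ∀ i, δ ≤ S.sOf u i := by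
  obtain ⟨δ, hδ, h⟩ := exists_quadPart_ge hN hemb hcoer
  refine ⟨δ, hδ, fun u hu i => ?_⟩
  have h1 := h _ (m_mem_nehari hu.1) i
  rw [quadPart_m hcoer hu.2] at h1
  exact (pow_le_pow_iff_left₀ hδ.le ((sOf_spec hu.1).1 i).le two_ne_zero).1 h1

theorem exists_sOf_le (hN : 1 ≤ N) (hemb : S.SobolevEmbedding) (hcoer : S.Coercive) (b : ℝ) :
    ∃ R : ℝ, 0 ≤ R ∧ ∀ u ∈ S.U, S.Psi u ≤ b → ∀ i, S.sOf u i ≤ R := by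
  have hp : 0 < 1 / 2 - 1 / S.p := by
    have := S.two_lt_p
    rw [sub_pos, div_lt_div_iff₀ (by linarith) two_pos]
    linarith
  refine ⟨Real.sqrt (b / (1 / 2 - 1 / S.p)), Real.sqrt_nonneg _, fun u hu hb i => ?_⟩
  refine Real.le_sqrt_of_sq_le ?_
  rw [le_div_iff₀ hp]
  have h1 : S.Psi u = (1 / 2 - 1 / S.p) * ∑ i, S.quadPart i (S.m u) :=
    J_eq_of_mem_nehari hN hemb hcoer (m_mem_nehari hu.1)
  have h2 : S.quadPart i (S.m u) ≤ ∑ i, S.quadPart i (S.m u) :=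
    Finset.single_le_sum (f := fun i => S.quadPart i (S.m u))
      (fun i _ => innerI_self_nonneg hemb hcoer i _) (Finset.mem_univ i)
  rw [quadPart_m hcoer hu.2] at h2
  nlinarith

/-! ### Comparison of dual norms, Palais–Smale sequences and critical points. -/

theorem hNorm_eq (hemb : S.SobolevEmbedding) (hcoer : S.Coercive) (u : S.HM) :
    S.hNorm u = Real.sqrt (∑ i, S.quadPart i u) := by
  unfold hNorm
  simp only [normI_sq hemb hcoer]
  rfl

theorem hNorm_pos (hemb : S.SobolevEmbedding) (hcoer : S.Coercive) {u : S.HM} (hu : u ≠ 0) :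
    0 < S.hNorm u := by
  obtain ⟨i, hi⟩ := Function.ne_iff.1 hu
  rw [hNorm_eq hemb hcoer]
  exact Real.sqrt_pos.2 (lt_of_lt_of_le (innerI_self_pos hemb hcoer i hi)
    (Finset.single_le_sum (f := fun i => S.quadPart i u)
      (fun i _ => innerI_self_nonneg hemb hcoer i _) (Finset.mem_univ i)))

theorem hNorm_le_of_quadPart_le (hemb : S.SobolevEmbedding) (hcoer : S.Coercive) {K : ℝ}
    (hK : 0 ≤ K) {u v : S.HM} (h : ∀ i, S.quadPart i u ≤ K ^ 2 * S.quadPart i v) :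
    S.hNorm u ≤ K * S.hNorm v := by
  rw [hNorm_eq hemb hcoer, hNorm_eq hemb hcoer]
  refine Real.sqrt_le_iff.2 ⟨by positivity, ?_⟩
  rw [mul_pow, Real.sq_sqrt (Finset.sum_nonneg fun i _ => innerI_self_nonneg hemb hcoer i (v i) :
    0 ≤ ∑ i, S.quadPart i v), Finset.mul_sum]
  exact Finset.sum_le_sum fun i _ => h i

theorem dualNorm_le_mul_dualNorm (hemb : S.SobolevEmbedding) (hcoer : S.Coercive)
    {V V' : Set S.HM} {f g : S.HM →L[ℝ] ℝ} {K : ℝ} (hK : 0 ≤ K)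
    (h : ∀ v ∈ V, ∃ v' ∈ V', f v = g v' ∧ S.hNorm v' ≤ K * S.hNorm v) :
    S.dualNorm V f ≤ ENNReal.ofReal K * S.dualNorm V' g := by
  refine iSup₂_le fun v hv => iSup_le fun hv0 => ?_
  obtain ⟨v', hv', hfg, hle⟩ := h v hv
  rcases eq_or_ne v' 0 with h0 | h0
  · rw [hfg, h0, map_zero, abs_zero, zero_div, ENNReal.ofReal_zero]
    exact bot_le
  · have hn := hNorm_pos hemb hcoer hv0
    have hn' := hNorm_pos hemb hcoer h0
    have h1 : |f v| / S.hNorm v ≤ K * (|g v'| / S.hNorm v') := by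
      rw [hfg, ← mul_div_assoc, div_le_div_iff₀ hn hn']
      nlinarith [abs_nonneg (g v')]
    calc ENNReal.ofReal (|f v| / S.hNorm v) ≤ ENNReal.ofReal (K * (|g v'| / S.hNorm v')) :=
          ENNReal.ofReal_le_ofReal h1
      _ = ENNReal.ofReal K * ENNReal.ofReal (|g v'| / S.hNorm v') := ENNReal.ofReal_mul hK
      _ ≤ _ := by
          gcongr
          exact le_iSup₂_of_le v' hv' (le_iSup_of_le h0 le_rfl)

/-- The preimage under `v ↦ s_u v` of the component of `v` tangent to `𝒯` at `u`. -/
def tangentPart (S : CompetitiveSystem N M) (u v : S.HM) : S.HM :=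
  S.scale (fun i => (S.sOf u i)⁻¹) fun i => v i + (-S.innerI i (u i) (v i)) • u i

theorem innerI_tangent (hcoer : S.Coercive) {i : Fin M} {x y : S.H} (hx : S.innerI i x x = 1) :
    S.innerI i x (y + (-S.innerI i x y) • x) = 0 := by
  obtain ⟨B, hB⟩ := S.exists_innerI_eq hcoer i
  simp only [← hB] at hx ⊢
  rw [map_add, map_smul, smul_eq_mul, hx]
  ring

theorem tangentPart_mem (hcoer : S.Coercive) {u : S.HM}
    (hu : u ∈ S.U) (v : S.HM) : S.tangentPart u v ∈ S.tangent u := by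
  intro i
  have h := innerI_smul_smul hcoer i 1 (S.sOf u i)⁻¹ (u i)
    (v i + (-S.innerI i (u i) (v i)) • u i)
  rw [one_smul, innerI_tangent hcoer ((mem_T_iff).1 hu.2 i), mul_zero] at h
  exact h

/-- After rescaling by `s_u`, the tangent part differs from `v` by componentwise multiples of `u`,
which `J'(m u)` does not see. -/
theorem fderiv_J_tangentPart {u : S.HM} (hu : u ∈ S.U) (v : S.HM) :
    fderiv ℝ S.J (S.m u) (S.scale (S.sOf u) (S.tangentPart u v)) = fderiv ℝ S.J (S.m u) v := by
  have e : S.scale (S.sOf u) (S.tangentPart u v) =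
      v + S.scale (fun i => -S.innerI i (u i) (v i)) u := by
    unfold tangentPart
    rw [scale_scale]
    simp only [mul_inv_cancel₀ ((sOf_spec hu.1).1 _).ne']
    rw [scale_one]
    rfl
  rw [e, map_add, fderiv_J_m_scale hu.1, add_zero]

/-- Orthogonal projection does not increase the norm, and dividing by `s_i ≥ δ` costs at most `δ⁻¹`.
-/
theorem quadPart_tangentPart_le (hemb : S.SobolevEmbedding) (hcoer : S.Coercive) {u : S.HM}
    (hu : u ∈ S.U) (v : S.HM) {δ : ℝ} (hδ : 0 < δ) (hs : ∀ i, δ ≤ S.sOf u i) (i : Fin M) :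
    S.quadPart i (S.tangentPart u v) ≤ δ⁻¹ ^ 2 * S.quadPart i v := by
  unfold tangentPart
  rw [quadPart_scale hcoer]
  have h1 : S.innerI i (u i) (u i) = 1 := (mem_T_iff).1 hu.2 i
  have h2 := innerI_add_smul hcoer i (v i) (u i) (-S.innerI i (u i) (v i))
  rw [h1, S.innerI_comm i (v i) (u i)] at h2
  have h3 : S.quadPart i (fun i => v i + (-S.innerI i (u i) (v i)) • u i) ≤ S.quadPart i v := by
    unfold quadPart
    rw [h2]
    nlinarith [sq_nonneg (S.innerI i (u i) (v i))]
  have h4 : 0 ≤ S.quadPart i v := innerI_self_nonneg hemb hcoer i _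
  have h5 : (S.sOf u i)⁻¹ ≤ δ⁻¹ := inv_anti₀ hδ (hs i)
  have h6 : 0 ≤ (S.sOf u i)⁻¹ := inv_nonneg.2 (hδ.le.trans (hs i))
  calc _ ≤ (S.sOf u i)⁻¹ ^ 2 * S.quadPart i v := mul_le_mul_of_nonneg_left h3 (sq_nonneg _)
    _ ≤ _ := by gcongr

theorem dualNorm_J_le (hN : 1 ≤ N) (hemb : S.SobolevEmbedding) (hcoer : S.Coercive) :
    ∃ K : ℝ, ∀ u ∈ S.U, S.dualNorm univ (fderiv ℝ S.J (S.m u)) ≤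
      ENNReal.ofReal K * S.dualNorm (S.tangent u) (S.dPsi u) := by
  obtain ⟨δ, hδ, h⟩ := exists_sOf_ge hN hemb hcoer
  refine ⟨δ⁻¹, fun u hu => dualNorm_le_mul_dualNorm hemb hcoer (by positivity) fun v _ =>
    ⟨S.tangentPart u v, tangentPart_mem hcoer hu v, ?_, ?_⟩⟩
  · rw [dPsi_apply hN hemb hcoer hu (tangentPart_mem hcoer hu v), fderiv_J_tangentPart hu]
  · exact hNorm_le_of_quadPart_le hemb hcoer (by positivity)
      (quadPart_tangentPart_le hemb hcoer hu v hδ (h u hu))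

theorem dualNorm_dPsi_le (hN : 1 ≤ N) (hemb : S.SobolevEmbedding) (hcoer : S.Coercive) (b : ℝ) :
    ∃ K : ℝ, ∀ u ∈ S.U, S.Psi u ≤ b → S.dualNorm (S.tangent u) (S.dPsi u) ≤
      ENNReal.ofReal K * S.dualNorm univ (fderiv ℝ S.J (S.m u)) := by
  obtain ⟨R, hR, h⟩ := exists_sOf_le hN hemb hcoer b
  refine ⟨R, fun u hu hb => dualNorm_le_mul_dualNorm hemb hcoer hR fun v hv =>
    ⟨S.scale (S.sOf u) v, mem_univ _, dPsi_apply hN hemb hcoer hu hv, ?_⟩⟩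
  refine hNorm_le_of_quadPart_le hemb hcoer hR fun i => ?_
  rw [quadPart_scale hcoer]
  have h1 := h u hu hb i
  have h2 : 0 ≤ S.sOf u i := ((sOf_spec hu.1).1 i).le
  have h4 : 0 ≤ S.quadPart i v := innerI_self_nonneg hemb hcoer i _
  gcongr

theorem isPSJ_of_isPSPsi (hN : 1 ≤ N) (hemb : S.SobolevEmbedding) (hcoer : S.Coercive) {c : ℝ}
    {u : ℕ → S.HM} (h : S.IsPSPsi c u) : S.IsPSJ c (fun n => S.m (u n)) := by
  obtain ⟨K, hK⟩ := dualNorm_J_le hN hemb hcoer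
  obtain ⟨hU, hc, hd⟩ := h
  refine ⟨hc, tendsto_of_tendsto_of_tendsto_of_le_of_le tendsto_const_nhds ?_
    (fun _ => bot_le) (fun n => hK (u n) (hU n))⟩
  simpa using ENNReal.Tendsto.const_mul hd (Or.inr (ENNReal.ofReal_ne_top (r := K)))

theorem isPSPsi_of_isPSJ (hN : 1 ≤ N) (hemb : S.SobolevEmbedding) (hcoer : S.Coercive) {c : ℝ}
    {u : ℕ → S.HM} (h : S.IsPSJ c u) (hu : ∀ n, u n ∈ S.nehari) :
    S.IsPSPsi c (fun n => S.mInv (u n)) := by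
  have hsurj := (bijOn_m hN hemb hcoer).surjOn
  have hU : ∀ n, S.mInv (u n) ∈ S.U := fun n => Function.invFunOn_mem (hsurj (hu n))
  have hm : ∀ n, S.m (S.mInv (u n)) = u n := fun n => Function.invFunOn_eq (hsurj (hu n))
  obtain ⟨hc, hd⟩ := h
  have hΨ : ∀ n, S.Psi (S.mInv (u n)) = S.J (u n) := fun n => congr_arg S.J (hm n)
  -- Convergent energies are bounded, which places the sequence in one sublevel set of `Ψ` and makes
  -- the constant `K` uniform.
  obtain ⟨b, hb⟩ := hc.bddAbove_range
  obtain ⟨K, hK⟩ := dualNorm_dPsi_le hN hemb hcoer b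
  refine ⟨hU, by simpa only [hΨ] using hc, ?_⟩
  refine tendsto_of_tendsto_of_tendsto_of_le_of_le
    (h := fun n => ENNReal.ofReal K * S.dualNorm univ (fderiv ℝ S.J (u n)))
    tendsto_const_nhds ?_ (fun _ => bot_le) (fun n => ?_)
  · simpa using ENNReal.Tendsto.const_mul hd (Or.inr (ENNReal.ofReal_ne_top (r := K)))
  · have := hK (S.mInv (u n)) (hU n) (by rw [hΨ]; exact hb (mem_range_self n))
    rwa [hm] at this

theorem criticalPoint_iff (hN : 1 ≤ N) (hemb : S.SobolevEmbedding) (hcoer : S.Coercive)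
    {u : S.HM} (hu : u ∈ S.U) : (∀ v ∈ S.tangent u, S.dPsi u v = 0) ↔
      ((∀ i, S.m u i ≠ 0) ∧ fderiv ℝ S.J (S.m u) = 0) := by
  constructor
  · refine fun h => ⟨fun i => (m_mem_nehari hu.1 i).1, ContinuousLinearMap.ext fun v => ?_⟩
    have ht := tangentPart_mem hcoer hu v
    rw [← fderiv_J_tangentPart hu, ← dPsi_apply hN hemb hcoer hu ht, h _ ht]
    rfl
  · rintro ⟨-, h⟩ v hv
    rw [dPsi_apply hN hemb hcoer hu hv, h]
    rfl

/-! ### Blow-up of `Ψ` at the boundary, and evenness. -/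

theorem continuous_nehariPart (hN : 1 ≤ N) (hcoer : S.Coercive) (i : Fin M) :
    Continuous (S.nehariPart i) :=
  ((contDiff_quadPart hcoer i).continuous.sub (contDiff_selfPart hN i).continuous).add
    (continuous_finsetSum _ fun _ hj => continuous_const.mul
      (contDiff_crossPart hN (Finset.mem_filter.1 hj).2.symm).continuous)

theorem tendsto_Psi_atTop (hN : 1 ≤ N) (hemb : S.SobolevEmbedding) (hcoer : S.Coercive)
    {u : ℕ → S.HM} {u₀ : S.HM} (hu : ∀ n, u n ∈ S.U) (hu₀ : u₀ ∈ S.boundaryU)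
    (hlim : Tendsto u atTop (𝓝 u₀)) : Tendsto (fun n => S.Psi (u n)) atTop atTop := by
  obtain ⟨x, hx, rfl⟩ := hu₀
  rw [(isOpen_preimage_U hN hemb hcoer).frontier_eq] at hx
  by_contra hcon
  rw [tendsto_atTop] at hcon
  push Not at hcon
  obtain ⟨b, hb⟩ := hcon
  obtain ⟨φ, hφ, hφb⟩ := extraction_of_frequently_atTop hb
  obtain ⟨δ, hδ, hge⟩ := exists_sOf_ge hN hemb hcoer
  obtain ⟨R, hR, hle⟩ := exists_sOf_le hN hemb hcoer b
  -- Along a subsequence with `Ψ < b` the scalings stay in the box `[δ, R]^M`. The lower bound keeps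
  -- the limit `s` positive, and the Nehari equations pass to the limit by continuity.
  obtain ⟨s, hs, ψ, hψ, hsψ⟩ := (isCompact_Icc (a := fun _ : Fin M => δ)
    (b := fun _ => R)).tendsto_subseq (x := fun n => S.sOf (u (φ n)))
    (fun n => ⟨fun i => hge _ (hu _) i, fun i => hle _ (hu _) (hφb n).le i⟩)
  have hu' : Tendsto (fun n => u (φ (ψ n))) atTop (𝓝 x.1) :=
    hlim.comp (hφ.tendsto_atTop.comp hψ.tendsto_atTop)
  have hmlim : Tendsto (fun n => S.m (u (φ (ψ n)))) atTop (𝓝 (S.scale s x.1)) :=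
    tendsto_pi_nhds.2 fun i => (tendsto_pi_nhds.1 hsψ i).smul (tendsto_pi_nhds.1 hu' i)
  have hspos : ∀ i, 0 < s i := fun i => hδ.trans_le (hs.1 i)
  have hmem : S.scale s x.1 ∈ S.nehari := by
    rw [mem_nehari_iff hN hemb hcoer]
    refine fun i => ⟨smul_ne_zero (hspos i).ne' fun h0 => ?_, ?_⟩
    -- No component of the limit vanishes, because the limit still lies in `𝒯`.
    · have h1 := (mem_T_iff).1 x.2 i
      have h2 := innerI_smul_smul hcoer i 0 0 (0 : S.H) 0
      rw [quadPart, h0] at h1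
      rw [zero_smul, h1] at h2
      norm_num at h2
    · have h1 := ((continuous_nehariPart hN hcoer i).tendsto _).comp hmlim
      refine tendsto_nhds_unique h1 (tendsto_const_nhds.congr fun n => ?_)
      exact (((mem_nehari_iff hN hemb hcoer _).1 (m_mem_nehari (hu (φ (ψ n))).1)) i).2.symm
  -- The limit belongs to `U`, which is open in `𝒯` and hence disjoint from its boundary.
  exact hx.2 ⟨⟨s, hspos, hmem⟩, x.2⟩

theorem scale_neg_one (u : S.HM) : S.scale (fun _ => -1) u = -u :=
  funext fun i => neg_one_smul ℝ (u i)

theorem J_neg (hemb : S.SobolevEmbedding) (hcoer : S.Coercive) (u : S.HM) : S.J (-u) = S.J u := by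
  rw [J_eq hemb hcoer, J_eq hemb hcoer, ← scale_neg_one]
  simp [quadPart_scale hcoer, selfPart_scale, crossPart_scale]

theorem neg_mem_nehari (hN : 1 ≤ N) (hemb : S.SobolevEmbedding) (hcoer : S.Coercive) {u : S.HM}
    (hu : u ∈ S.nehari) : -u ∈ S.nehari := by
  rw [mem_nehari_iff hN hemb hcoer] at hu ⊢
  refine fun i => ⟨neg_ne_zero.2 (hu i).1, ?_⟩
  rw [← (hu i).2, ← scale_neg_one]
  simp [nehariPart, quadPart_scale hcoer, selfPart_scale, crossPart_scale]

theorem scale_neg (s : Fin M → ℝ) (u : S.HM) : S.scale s (-u) = -S.scale s u :=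
  funext fun i => smul_neg (s i) (u i)

theorem neg_mem_U_and_Psi_neg (hN : 1 ≤ N) (hemb : S.SobolevEmbedding) (hcoer : S.Coercive)
    {u : S.HM} (hu : u ∈ S.U) : -u ∈ S.U ∧ S.Psi u = S.Psi (-u) := by
  obtain ⟨hs, hn⟩ := sOf_spec hu.1
  have hn' : S.scale (S.sOf u) (-u) ∈ S.nehari := by
    rw [scale_neg]
    exact neg_mem_nehari hN hemb hcoer hn
  refine ⟨⟨⟨_, hs, hn'⟩, (mem_T_iff).2 fun i => ?_⟩, ?_⟩
  · rw [← scale_neg_one, quadPart_scale hcoer, (mem_T_iff).1 hu.2 i]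
    norm_num
  · unfold Psi m
    rw [sOf_eq hN hemb hcoer hs hn', scale_neg, J_neg hemb hcoer]

end CompetitiveSystem

end

theorem theoremA {N M : ℕ} (hN : 1 ≤ N) (S : CompetitiveSystem N M)
    (hemb : S.SobolevEmbedding) (hcoer : S.Coercive) :
    -- the objects in the statement are well defined
    ContDiff ℝ 1 S.J ∧
    (∀ u ∈ S.Utilde, ∃! s : Fin M → ℝ, (∀ i, 0 < s i) ∧ S.scale s u ∈ S.nehari) ∧
    IsOpen ((Subtype.val : S.T → S.HM) ⁻¹' S.U) ∧
    Set.BijOn S.m S.U S.nehari ∧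
    -- (i)
    (ContDiffOn ℝ 1 S.Psi S.U ∧
      ∀ u ∈ S.U, ∀ v ∈ S.tangent u,
        S.dPsi u v = fderiv ℝ S.J (S.m u) (S.scale (S.sOf u) v)) ∧
    -- (ii)
    ((∀ (c : ℝ) (u : ℕ → S.HM), S.IsPSPsi c u → S.IsPSJ c (fun n => S.m (u n))) ∧
      ∀ (c : ℝ) (u : ℕ → S.HM), S.IsPSJ c u → (∀ n, u n ∈ S.nehari) →
        S.IsPSPsi c (fun n => S.mInv (u n))) ∧
    -- (iii)
    (∀ u ∈ S.U, (∀ v ∈ S.tangent u, S.dPsi u v = 0) ↔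
      ((∀ i, S.m u i ≠ 0) ∧ fderiv ℝ S.J (S.m u) = 0)) ∧
    -- (iv)
    (∀ (u : ℕ → S.HM) (u₀ : S.HM), (∀ n, u n ∈ S.U) → u₀ ∈ S.boundaryU →
      Tendsto u atTop (𝓝 u₀) → Tendsto (fun n => S.Psi (u n)) atTop atTop) ∧
    -- (v)
    (∀ u ∈ S.U, -u ∈ S.U ∧ S.Psi u = S.Psi (-u)) := by
  refine ⟨CompetitiveSystem.contDiff_J hN hemb hcoer,
    fun u hu => CompetitiveSystem.existsUnique_scale_mem_nehari hN hemb hcoer hu,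
    CompetitiveSystem.isOpen_preimage_U hN hemb hcoer,
    CompetitiveSystem.bijOn_m hN hemb hcoer,
    ⟨fun u hu => ?_, fun u hu v hv => ?_⟩,
    ⟨fun c u h => ?_, fun c u h hu => ?_⟩, fun u hu => ?_, fun u u₀ hu hu₀ hlim => ?_,
    fun u hu => ?_⟩
  · exact (CompetitiveSystem.contDiffAt_Psi hN hemb hcoer hu.1).contDiffWithinAt
  · exact CompetitiveSystem.dPsi_apply hN hemb hcoer hu hv
  · exact CompetitiveSystem.isPSJ_of_isPSPsi hN hemb hcoer h
  · exact CompetitiveSystem.isPSPsi_of_isPSJ hN hemb hcoer h hu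
  · exact CompetitiveSystem.criticalPoint_iff hN hemb hcoer hu
  · exact CompetitiveSystem.tendsto_Psi_atTop hN hemb hcoer hu hu₀ hlim
  · exact CompetitiveSystem.neg_mem_U_and_Psi_neg hN hemb hcoer hu
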